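/- Let $n = 2m+1$ with $m \ge 1$, and let $Cl_n$ be the real Clifford algebra generated by $e_1,\dots,e_n$ with $e_ie_j+e_je_i=-2\delta_{ij}$. Let $\mathfrak{spin}(n)\subset Cl_n$ be the Lie algebra spanned by the commutators $[e_k,e_l]$, and let weights $\lambda=(\lambda^1,\dots,\lambda^m)$ and highest weights refer to the Cartan subalgebra spanned by the $[e_{2j-1},e_{2j}]$ (acting on a vector of weight $\lambda$ by $4\sqrt{-1}\,\lambda^j$) and to the positive roots $\varepsilon_i\pm\varepsilon_j$ $(i<j)$, $\varepsilon_i$. Let $V_\Delta$ be a spinor space, i.e. a finite-dimensional irreducible complex module over $Cl_n$. For $q\ge 0$ let $H^q$ be the space of complex harmonic homogeneous polynomials of degree $q$ on $\mathbf R^n$. Let $[e_k,e_l]\in\mathfrak{spin}(n)$ act on polynomials by $4(-x_k\partial_l+x_l\partial_k)$, on $V_\Delta$ through the Clifford action, and on $H^q\otimes V_\Delta$ by the tensor product representation. On $V_\Delta$-valued polynomials let $x=\sum_i x_ie_i$ (Clifford multiplication) and $D=\sum_i e_i\,\partial/\partial x_i$ (Dirac operator). Then $V_\Delta$ is an irreducible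 representation of $\mathfrak{spin}(n)$ with highest weight $\Delta=((1/2)_m)$, where $(1/2)_j$ denotes a string of $j$ entries $1/2$. Moreover $H^q\otimes V_\Delta$ has a direct sum decomposition $$H^q\otimes V_\Delta = V_{\mu_0}\oplus V_{\mu_1},\qquad \mu_0=(q+\tfrac12,(\tfrac12)_{m-1}),\quad \mu_1=(q-\tfrac12,(\tfrac12)_{m-1}),$$ where $V_{\mu}$ is an irreducible subrepresentation of $\mathfrak{spin}(n)$ with highest weight $\mu$; for $q=0$ the weight $\mu_1$ is not dominant and the summand $V_{\mu_1}$ is $0$. For every such decomposition, $$-xD = 0 \ \text{ on } V_{\mu_0},\qquad -xD = n+2q-2 \ \text{ on } V_{\mu_1},$$ and in particular $V_{\mu_0}=\ker D$, the kernel of $D$ on $H^q\otimes V_\Delta$, and $V_{\mu_1}\cong (H^q\otimes V_\Delta)/\ker D$ by the quotient map. -/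

import Mathlib

open scoped TensorProduct

attribute [local instance 100] LieRing.ofAssociativeRing

namespace SpinorHarmonic

noncomputable section

/-! ### The Clifford algebra and the Lie algebra `spin(n)` -/

/-- The negative definite form `v ↦ -(v₁² + ⋯ + vₙ²)` on `ℝⁿ`. -/
abbrev negForm (n : ℕ) : QuadraticForm ℝ (Fin n → ℝ) :=
  QuadraticMap.weightedSumSquares ℝ (fun _ : Fin n => (-1 : ℝ))

/-- The Clifford algebra of `ℝⁿ`, with `eᵢ eⱼ + eⱼ eᵢ = -2 δᵢⱼ`. -/
abbrev Cl (n : ℕ) : Type := CliffordAlgebra (negForm n)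

/-- The standard generators `eᵢ` of the Clifford algebra. -/
def e {n : ℕ} (i : Fin n) : Cl n := CliffordAlgebra.ι (negForm n) (Pi.single i 1)

theorem e_mul_e_add {n : ℕ} (i j : Fin n) :
    e i * e j + e j * e i = algebraMap ℝ (Cl n) (if i = j then -2 else 0) := by
  rw [e, e, CliffordAlgebra.ι_mul_ι_add_swap]
  congr 1
  simp only [QuadraticMap.polar, QuadraticMap.weightedSumSquares_apply, Pi.add_apply, smul_eq_mul,
    ← Finset.sum_sub_distrib]
  have h : ∀ k : Fin n, -1 * (((Pi.single i 1 : Fin n → ℝ) k + (Pi.single j 1 : Fin n → ℝ) k) *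
      ((Pi.single i 1 : Fin n → ℝ) k + (Pi.single j 1 : Fin n → ℝ) k)) -
      -1 * ((Pi.single i 1 : Fin n → ℝ) k * (Pi.single i 1 : Fin n → ℝ) k) -
      -1 * ((Pi.single j 1 : Fin n → ℝ) k * (Pi.single j 1 : Fin n → ℝ) k) =
      (Pi.single i 1 : Fin n → ℝ) k * (-2 * (Pi.single j 1 : Fin n → ℝ) k) := fun k => by ring
  rw [Finset.sum_congr rfl fun k _ => h k]
  by_cases hij : i = j
  · subst hij
    simp [Pi.single_apply]
  · simp [Pi.single_apply, hij, Ne.symm hij]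

theorem lie_e_e_e {n : ℕ} (k l i : Fin n) :
    ⁅⁅(e k : Cl n), e l⁆, e i⁆ =
      (if i = k then (4 : ℝ) else 0) • e l - (if i = l then (4 : ℝ) else 0) • e k := by
  have h1 := e_mul_e_add l i
  have h2 := e_mul_e_add k i
  have key : ⁅⁅(e k : Cl n), e l⁆, e i⁆ =
      e k * (e l * e i + e i * e l) - (e k * e i + e i * e k) * e l
        - e l * (e k * e i + e i * e k) + (e l * e i + e i * e l) * e k := by
    simp only [Ring.lie_def]
    noncomm_ring
  rw [key, h1, h2, ← Algebra.commutes, ← Algebra.commutes (_ : ℝ) (e l), ← Algebra.smul_def,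
    ← Algebra.smul_def]
  simp only [eq_comm (a := i)]
  split_ifs <;> module

/-- `spin(n)`: the linear span of the commutators `[eₖ, eₗ]` in the Clifford algebra, with the
commutator bracket. -/
def spinLie (n : ℕ) : LieSubalgebra ℝ (Cl n) where
  __ := Submodule.span ℝ (Set.range fun p : Fin n × Fin n => ⁅(e p.1 : Cl n), e p.2⁆)
  lie_mem' := by
    intro x y hx hy
    change x ∈ Submodule.span ℝ _ at hx
    change y ∈ Submodule.span ℝ _ at hy
    change ⁅x, y⁆ ∈ Submodule.span ℝ _
    induction hx using Submodule.span_induction with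
    | zero => simp
    | add a b _ _ ha hb => rw [add_lie]; exact Submodule.add_mem _ ha hb
    | smul c a _ ha => rw [smul_lie]; exact Submodule.smul_mem _ c ha
    | mem a ha =>
      obtain ⟨⟨k, l⟩, rfl⟩ := ha
      induction hy using Submodule.span_induction with
      | zero => simp
      | add a b _ _ ha hb => rw [lie_add]; exact Submodule.add_mem _ ha hb
      | smul c a _ ha => rw [lie_smul]; exact Submodule.smul_mem _ c ha
      | mem b hb =>
        obtain ⟨⟨i, j⟩, rfl⟩ := hb
        have hm : ∀ a b : Fin n, ⁅(e a : Cl n), e b⁆ ∈ Submodule.span ℝ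
            (Set.range fun p : Fin n × Fin n => ⁅(e p.1 : Cl n), e p.2⁆) :=
          fun a b => Submodule.subset_span ⟨(a, b), rfl⟩
        simp only
        rw [leibniz_lie, lie_e_e_e, lie_e_e_e, sub_lie, lie_sub, smul_lie, smul_lie, lie_smul,
          lie_smul]
        exact Submodule.add_mem _
          (Submodule.sub_mem _ (Submodule.smul_mem _ _ (hm _ _)) (Submodule.smul_mem _ _ (hm _ _)))
          (Submodule.sub_mem _ (Submodule.smul_mem _ _ (hm _ _)) (Submodule.smul_mem _ _ (hm _ _)))

/-- The element `[eₖ, eₗ]` of `spin(n)`. -/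
def br {n : ℕ} (k l : Fin n) : spinLie n :=
  ⟨⁅(e k : Cl n), e l⁆, Submodule.subset_span ⟨(k, l), rfl⟩⟩

/-- The projection of the Clifford algebra onto its vectors, a left inverse of `ι`. -/
def vec (n : ℕ) : Cl n →ₗ[ℝ] (Fin n → ℝ) :=
  ExteriorAlgebra.ιInv ∘ₗ (CliffordAlgebra.equivExterior (negForm n)).toLinearMap

theorem vec_e {n : ℕ} (i : Fin n) : vec n (e i) = Pi.single i 1 := by
  simp [vec, e, CliffordAlgebra.equivExterior, ExteriorAlgebra.ι_leftInverse _]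

/-- The matrix entries of the adjoint action on `ℝⁿ`: `[A, eⱼ] = ∑ᵢ (adEntry A i j) eᵢ` for
`A ∈ spin(n)`. -/
def adEntry {n : ℕ} (A : Cl n) (i j : Fin n) : ℝ := vec n ⁅A, e j⁆ i

theorem lie_e_eq_sum {n : ℕ} (A : spinLie n) (j : Fin n) :
    ⁅(A : Cl n), e j⁆ = ∑ i, adEntry (A : Cl n) i j • e i := by
  obtain ⟨A, hA⟩ := A
  change A ∈ Submodule.span ℝ _ at hA
  simp only
  induction hA using Submodule.span_induction with
  | zero => simp [adEntry]
  | add a b _ _ ha hb =>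
    rw [add_lie, ha, hb, ← Finset.sum_add_distrib]
    simp [adEntry, add_lie, add_smul]
  | smul c a _ ha =>
    rw [smul_lie, ha, Finset.smul_sum]
    simp [adEntry, smul_lie, smul_smul]
  | mem a ha =>
    obtain ⟨⟨k, l⟩, rfl⟩ := ha
    have h : ∀ (c : ℝ) (l : Fin n), ∑ i, (c • (Pi.single l 1 : Fin n → ℝ)) i • (e i : Cl n) =
        c • e l := fun c l => by
      simp [Pi.single_apply]
    simp only [adEntry, lie_e_e_e]
    generalize (if j = k then (4 : ℝ) else 0) = c
    generalize (if j = l then (4 : ℝ) else 0) = d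
    rw [map_sub, map_smul, map_smul, vec_e, vec_e]
    simp only [Pi.sub_apply, sub_smul, Finset.sum_sub_distrib, h]

theorem adEntry_lie {n : ℕ} (A B : spinLie n) (i j : Fin n) :
    adEntry (⁅A, B⁆ : spinLie n) i j =
      ∑ k, (adEntry (A : Cl n) i k * adEntry (B : Cl n) k j -
        adEntry (B : Cl n) i k * adEntry (A : Cl n) k j) := by
  have h : ⁅((⁅A, B⁆ : spinLie n) : Cl n), e j⁆ =
      ⁅(A : Cl n), ⁅(B : Cl n), e j⁆⁆ - ⁅(B : Cl n), ⁅(A : Cl n), e j⁆⁆ := by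
    rw [LieSubalgebra.coe_bracket, lie_lie]
  rw [adEntry, h, lie_e_eq_sum B, lie_e_eq_sum A]
  simp only [lie_sum, lie_smul, map_sub, map_sum, map_smul, Pi.sub_apply, Finset.sum_apply,
    Pi.smul_apply, smul_eq_mul, Finset.sum_sub_distrib]
  congr 1 <;> exact Finset.sum_congr rfl fun k _ => mul_comm _ _

/-! ### Representations of `spin(n)` -/

/-- A representation of `spin(n)` on a complex vector space. -/
abbrev SpinRep (n : ℕ) (U : Type*) [AddCommGroup U] [Module ℂ U] :=
  spinLie n →ₗ⁅ℝ⁆ Module.End ℂ U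

/-- The vector field `-∑ᵢⱼ aᵢⱼ xⱼ ∂ᵢ`, where `a` is the matrix of the adjoint action of `A`. -/
def polyDer {n : ℕ} (A : Cl n) : Derivation ℂ (MvPolynomial (Fin n) ℂ) (MvPolynomial (Fin n) ℂ) :=
  MvPolynomial.mkDerivation ℂ
    fun i => -∑ j, MvPolynomial.C (adEntry A i j : ℂ) * MvPolynomial.X j

/-- The polynomial representation of `spin(n)`, the derivative of `f ↦ f ∘ g⁻¹`. -/
def polyRep (n : ℕ) : SpinRep n (MvPolynomial (Fin n) ℂ) where
  toFun A := (polyDer (A : Cl n)).toLinearMap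
  map_add' A B := by
    have : polyDer ((A + B : spinLie n) : Cl n) = polyDer (A : Cl n) + polyDer (B : Cl n) := by
      refine MvPolynomial.derivation_ext fun i => ?_
      simp only [polyDer, Derivation.add_apply, MvPolynomial.mkDerivation_X, ← neg_add,
        ← Finset.sum_add_distrib]
      simp [adEntry, add_lie, add_mul]
    rw [this]; rfl
  map_smul' c A := by
    have : polyDer ((c • A : spinLie n) : Cl n) = (c : ℂ) • polyDer (A : Cl n) := by
      refine MvPolynomial.derivation_ext fun i => ?_
      simp only [polyDer, Derivation.smul_apply, MvPolynomial.mkDerivation_X, smul_neg,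
        Finset.smul_sum]
      simp [adEntry, smul_lie, MvPolynomial.smul_eq_C_mul, mul_assoc]
    rw [this]; rfl
  map_lie' {A B} := by
    have : polyDer ((⁅A, B⁆ : spinLie n) : Cl n) = ⁅polyDer (A : Cl n), polyDer (B : Cl n)⁆ := by
      refine MvPolynomial.derivation_ext fun i => ?_
      rw [Derivation.commutator_apply]
      have h : ∀ A B : Cl n, polyDer A (polyDer B (MvPolynomial.X i)) =
          ∑ j, ∑ k, MvPolynomial.C (adEntry B i k * adEntry A k j : ℂ) * MvPolynomial.X j := by
        intro A B
        simp only [polyDer, MvPolynomial.mkDerivation_X, map_neg, map_sum, Derivation.leibniz,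
          MvPolynomial.derivation_C, smul_eq_mul, mul_zero, add_zero, mul_neg,
          Finset.mul_sum, Finset.sum_neg_distrib, neg_neg, map_mul, mul_assoc]
        exact Finset.sum_comm
      rw [h, h, ← Finset.sum_sub_distrib]
      simp only [polyDer, MvPolynomial.mkDerivation_X, adEntry_lie]
      rw [← Finset.sum_neg_distrib]
      refine Finset.sum_congr rfl fun j _ => ?_
      rw [← Finset.sum_mul, ← Finset.sum_mul, ← sub_mul, ← neg_mul, ← Finset.sum_sub_distrib]
      congr 1
      simp only [Complex.ofReal_sum, map_sum, Complex.ofReal_sub, Complex.ofReal_mul, map_sub,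
        ← Finset.sum_neg_distrib, neg_sub]
    rw [this]; rfl

/-- `[eₖ, eₗ]` acts on polynomials as `4 (-xₖ ∂ₗ + xₗ ∂ₖ)`. -/
theorem polyRep_br {n : ℕ} (k l : Fin n) (f : MvPolynomial (Fin n) ℂ) :
    polyRep n (br k l) f =
      4 * (-(MvPolynomial.X k * MvPolynomial.pderiv l f) +
        MvPolynomial.X l * MvPolynomial.pderiv k f) := by
  have : polyDer ((br k l : spinLie n) : Cl n) =
      (4 : MvPolynomial (Fin n) ℂ) • (-(MvPolynomial.X k : MvPolynomial (Fin n) ℂ) •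
        MvPolynomial.pderiv l + (MvPolynomial.X l : MvPolynomial (Fin n) ℂ) •
        MvPolynomial.pderiv k) := by
    refine MvPolynomial.derivation_ext fun i => ?_
    have h4 : (MvPolynomial.C (4 : ℂ) : MvPolynomial (Fin n) ℂ) = 4 := map_ofNat _ 4
    have h : ∀ j, adEntry ((br k l : spinLie n) : Cl n) i j =
        (if j = k then (4 : ℝ) else 0) * (if i = l then 1 else 0) -
          (if j = l then (4 : ℝ) else 0) * (if i = k then 1 else 0) := fun j => by
      simp only [adEntry, br, lie_e_e_e]
      rw [map_sub, map_smul, map_smul, vec_e, vec_e]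
      simp only [Pi.sub_apply, Pi.smul_apply, Pi.single_apply, smul_eq_mul]
    have hsum : ∀ a b : ℝ, ∑ j, (MvPolynomial.C (((if j = k then (4 : ℝ) else 0) * a -
        (if j = l then (4 : ℝ) else 0) * b : ℝ) : ℂ) : MvPolynomial (Fin n) ℂ) *
          MvPolynomial.X j = 4 * MvPolynomial.C (a : ℂ) * MvPolynomial.X k -
            4 * MvPolynomial.C (b : ℂ) * MvPolynomial.X l := fun a b => by
      simp only [Complex.ofReal_sub, Complex.ofReal_mul, map_sub, map_mul, sub_mul,
        Finset.sum_sub_distrib]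
      simp [apply_ite Complex.ofReal, apply_ite MvPolynomial.C, h4]
    simp only [polyDer, MvPolynomial.mkDerivation_X, h, hsum, Derivation.smul_apply,
      Derivation.add_apply, MvPolynomial.pderiv_X, smul_eq_mul, Pi.single_apply]
    simp only [eq_comm (a := i)]
    split_ifs <;> simp <;> ring
  change polyDer ((br k l : spinLie n) : Cl n) f = _
  rw [this]
  simp [mul_add]

variable {n : ℕ} {V : Type*} [AddCommGroup V] [Module ℂ V]

/-- A complex Clifford module restricts to a representation of `spin(n)`. -/
def spinorRep (γ : Cl n →ₐ[ℝ] Module.End ℂ V) : SpinRep n V where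
  toFun A := γ (A : Cl n)
  map_add' A B := by simp
  map_smul' c A := by simp
  map_lie' {A B} := by simp [Ring.lie_def]

/-- The tensor product of two representations: `A (f ⊗ φ) = A f ⊗ φ + f ⊗ A φ`. -/
def tensorRep {U : Type*} [AddCommGroup U] [Module ℂ U] (ρ : SpinRep n U) (σ : SpinRep n V) :
    SpinRep n (U ⊗[ℂ] V) where
  toFun A := TensorProduct.map (ρ A) LinearMap.id + TensorProduct.map LinearMap.id (σ A)
  map_add' A B := by
    refine TensorProduct.ext' fun f φ => ?_
    simp [TensorProduct.add_tmul, TensorProduct.tmul_add]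
    abel
  map_smul' c A := by
    refine TensorProduct.ext' fun f φ => ?_
    have h₁ : ρ (c • A) f = (c : ℂ) • ρ A f := by rw [map_smul]; rfl
    have h₂ : σ (c • A) φ = (c : ℂ) • σ A φ := by rw [map_smul]; rfl
    change ρ (c • A) f ⊗ₜ[ℂ] φ + f ⊗ₜ[ℂ] σ (c • A) φ =
      (c : ℂ) • (ρ A f ⊗ₜ[ℂ] φ + f ⊗ₜ[ℂ] σ A φ)
    rw [h₁, h₂, smul_add, TensorProduct.tmul_smul]
    rfl
  map_lie' {A B} := by
    refine TensorProduct.ext' fun f φ => ?_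
    simp [Ring.lie_def, TensorProduct.sub_tmul, TensorProduct.tmul_sub]
    abel

/-- `W` is an irreducible subrepresentation of `ρ`. -/
structure IsIrreducibleOn {U : Type*} [AddCommGroup U] [Module ℂ U] (ρ : SpinRep n U)
    (W : Submodule ℂ U) : Prop where
  ne_bot : W ≠ ⊥
  invariant : ∀ A, ∀ w ∈ W, ρ A w ∈ W
  eq_bot_or_eq : ∀ W' ≤ W, (∀ A, ∀ w ∈ W', ρ A w ∈ W') → W' = ⊥ ∨ W' = W

/-- The action of the element `[u, v] = ∑ uₖ vₗ [eₖ, eₗ]` of the complexification of `spin(n)`,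
for `u, v ∈ ℂⁿ`. -/
def brC {U : Type*} [AddCommGroup U] [Module ℂ U] (ρ : SpinRep n U) (u v : Fin n → ℂ) :
    Module.End ℂ U :=
  ∑ k, ∑ l, (u k * v l) • ρ (br k l)

section Weights

variable {m : ℕ}

/-- The indices of the basis vectors `e₁, e₃, …, e₂ₘ₋₁` (one-based). -/
def idxA (j : Fin m) : Fin (2 * m + 1) := ⟨2 * j, by omega⟩

/-- The indices of the basis vectors `e₂, e₄, …, e₂ₘ` (one-based). -/
def idxB (j : Fin m) : Fin (2 * m + 1) := ⟨2 * j + 1, by omega⟩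

/-- The vector `wⱼ = e₂ⱼ₋₁ - i e₂ⱼ` of `ℂ²ᵐ⁺¹`, of weight `εⱼ`. -/
def wPos (j : Fin m) : Fin (2 * m + 1) → ℂ :=
  Pi.single (idxA j) 1 - Complex.I • Pi.single (idxB j) 1

/-- The vector `w̄ⱼ = e₂ⱼ₋₁ + i e₂ⱼ` of `ℂ²ᵐ⁺¹`, of weight `-εⱼ`. -/
def wNeg (j : Fin m) : Fin (2 * m + 1) → ℂ :=
  Pi.single (idxA j) 1 + Complex.I • Pi.single (idxB j) 1

/-- The vector `e₂ₘ₊₁` of `ℂ²ᵐ⁺¹`, of weight `0`. -/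
def wZero (m : ℕ) : Fin (2 * m + 1) → ℂ := Pi.single (Fin.last (2 * m)) 1

/-- `v` is a highest weight vector of weight `wt`, for the Cartan subalgebra spanned by the
`[e₂ⱼ₋₁, e₂ⱼ]` and the positive roots `εᵢ ± εⱼ` (`i < j`) and `εᵢ`, which are the
lexicographically positive ones; their root vectors are `[wᵢ, wⱼ]`, `[wᵢ, w̄ⱼ]` and
`[wᵢ, e₂ₘ₊₁]`. Since `ad [eₖ, eₗ]` rotates the plane of `eₖ, eₗ` with speed `4`, the weight is
read off from `[e₂ⱼ₋₁, e₂ⱼ] v = 4 i wtⱼ v`. -/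
structure IsHighestWeightVector {U : Type*} [AddCommGroup U] [Module ℂ U]
    (ρ : SpinRep (2 * m + 1) U) (wt : Fin m → ℝ) (v : U) : Prop where
  ne_zero : v ≠ 0
  weight : ∀ j, ρ (br (idxA j) (idxB j)) v = (4 * Complex.I * (wt j : ℂ)) • v
  root_add : ∀ i j, i < j → brC ρ (wPos i) (wPos j) v = 0
  root_sub : ∀ i j, i < j → brC ρ (wPos i) (wNeg j) v = 0
  root_short : ∀ i, brC ρ (wPos i) (wZero m) v = 0

/-- `W` is an irreducible subrepresentation of `ρ` with highest weight `wt`. -/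
def IsIrrepOfHighestWeight {U : Type*} [AddCommGroup U] [Module ℂ U]
    (ρ : SpinRep (2 * m + 1) U) (wt : Fin m → ℝ) (W : Submodule ℂ U) : Prop :=
  IsIrreducibleOn ρ W ∧ ∃ v ∈ W, IsHighestWeightVector ρ wt v

/-- The spinor weight `Δ = (1/2, …, 1/2)`. -/
def wtSpin (m : ℕ) : Fin m → ℝ := fun _ => 1 / 2

/-- The weight `(a, 1/2, …, 1/2)`. -/
def wtHook (m : ℕ) (a : ℝ) : Fin m → ℝ := fun j => if (j : ℕ) = 0 then a else 1 / 2

end Weights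

/-- The subspace `W` of `H` maps isomorphically onto the quotient of `H` by `H ∩ K`. -/
def IsQuotientOf {U : Type*} [AddCommGroup U] [Module ℂ U] (W H K : Submodule ℂ U) : Prop :=
  ∃ h : W ≤ H, Function.Bijective ((K.submoduleOf H).mkQ ∘ₗ Submodule.inclusion h)

/-! ### Spinor-valued harmonic polynomials -/

/-- `γ` makes `V` a space of spinors: `V` is an irreducible complex module over the Clifford
algebra. -/
structure IsSpinorModule (γ : Cl n →ₐ[ℝ] Module.End ℂ V) : Prop where
  nontrivial : Nontrivial V
  eq_bot_or_eq_top : ∀ W : Submodule ℂ V, (∀ a, ∀ w ∈ W, γ a w ∈ W) → W = ⊥ ∨ W = ⊤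

/-- `∑ᵢ ∂²/∂xᵢ²` on complex polynomials in `n` variables. -/
def laplacian (n : ℕ) : Module.End ℂ (MvPolynomial (Fin n) ℂ) :=
  ∑ i, (MvPolynomial.pderiv i).toLinearMap ∘ₗ (MvPolynomial.pderiv i).toLinearMap

/-- `H^q`: the harmonic homogeneous polynomials of degree `q`. -/
def harmonic (n q : ℕ) : Submodule ℂ (MvPolynomial (Fin n) ℂ) :=
  MvPolynomial.homogeneousSubmodule (Fin n) ℂ q ⊓ LinearMap.ker (laplacian n)

/-- `H^q ⊗ V` as a subspace of the space of all `V`-valued polynomials. -/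
def harmonicTensor (n q : ℕ) (V : Type*) [AddCommGroup V] [Module ℂ V] :
    Submodule ℂ (MvPolynomial (Fin n) ℂ ⊗[ℂ] V) :=
  LinearMap.range ((harmonic n q).subtype.rTensor V)

/-- Clifford multiplication `x = ∑ xᵢ eᵢ` on spinor-valued polynomials. -/
def cliffordX (γ : Cl n →ₐ[ℝ] Module.End ℂ V) : Module.End ℂ (MvPolynomial (Fin n) ℂ ⊗[ℂ] V) :=
  ∑ i, TensorProduct.map (LinearMap.mulLeft ℂ (MvPolynomial.X i)) (γ (e i))

/-- The Dirac operator `D = ∑ eᵢ ∂/∂xᵢ` on spinor-valued polynomials. -/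
def dirac (γ : Cl n →ₐ[ℝ] Module.End ℂ V) : Module.End ℂ (MvPolynomial (Fin n) ℂ ⊗[ℂ] V) :=
  ∑ i, TensorProduct.map (MvPolynomial.pderiv i).toLinearMap (γ (e i))

/-- The action of `spin(n)` on spinor-valued polynomials. -/
def spinorPolyRep (γ : Cl n →ₐ[ℝ] Module.End ℂ V) : SpinRep n (MvPolynomial (Fin n) ℂ ⊗[ℂ] V) :=
  tensorRep (polyRep n) (spinorRep γ)

/-- `H^q ⊗ V = W₀ ⊕ W₁`, where `W₀` is irreducible with highest weight `(q + 1/2, 1/2, …, 1/2)` and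
`W₁` is irreducible with highest weight `(q - 1/2, 1/2, …, 1/2)`. For `q = 0` the latter weight is
not dominant, and the second component is absent. -/
structure IsSpinorDecomposition {m : ℕ} (γ : Cl (2 * m + 1) →ₐ[ℝ] Module.End ℂ V) (q : ℕ)
    (W₀ W₁ : Submodule ℂ (MvPolynomial (Fin (2 * m + 1)) ℂ ⊗[ℂ] V)) : Prop where
  irrep₀ : IsIrrepOfHighestWeight (spinorPolyRep γ) (wtHook m (q + 1 / 2)) W₀
  irrep₁ : 1 ≤ q → IsIrrepOfHighestWeight (spinorPolyRep γ) (wtHook m (q - 1 / 2)) W₁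
  absent : q = 0 → W₁ = ⊥
  disjoint : Disjoint W₀ W₁
  sup_eq : W₀ ⊔ W₁ = harmonicTensor (2 * m + 1) q V

end

end SpinorHarmonic

/-! Let Δ be the Laplacian, E the Euler operator and M_q the space of V-valued polynomials of degree
q killed by D (the monogenic ones). The decomposition rests on two relations, D² = -Δ and Dx = -xD -
2E - n. They show that monogenics are harmonic, that D maps H^q ⊗ V into M_{q-1}, and that Dx is the
nonzero scalar -(n+2q-2) on M_{q-1}. Hence H^q ⊗ V = M_q ⊕ x M_{q-1}, with -xD equal to 0 and n+2q-2
on the summands. Rotations commute with x, D and E, so x carries M_{q-1} isomorphically, as a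
representation, onto its image.

The main point is that M_q is irreducible (`WeylClifford.eq_zero_of_rot_plane`,
`exists_planeOp_pow_mem`, `eq_monogenic_of_isRotInvariant`). Put z = x₁ - i x₂ and Γ = e₁ - i e₂,
with z̄ and Γ̄ having the opposite sign. A nonzero invariant W ⊆ M_q contains a nonzero f killed by
all [Γ, e_k], k ≥ 3, because these shift the eigenvalues of [e₁, e₂]. A monogenic f of this kind is
z^q v with Γv = 0. Since ker Γ is irreducible under the products e_k e_l with k, l ≥ 3, W contains
z^q v for every v in ker Γ. Instead of complete reducibility, duality finishes the argument: under
the Fischer pairing (p(∂)r)(0), the V*-valued monogenics annihilating W form an invariant space. If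
W ≠ M_q this space is nonzero, hence contains some z̄^q φ with φ ≠ 0 and φ = 0 on im Γ̄. Its pairing
with z^q v is q! 2^q φ(v), so φ vanishes on ker Γ too. But V = ker Γ + im Γ̄, a contradiction.

For an arbitrary decomposition, a vector of weight q + 1/2 in degree q is monogenic, because weights
in degree q-1 are at most q - 1/2 (`WeylClifford.eq_zero_of_weight`). This forces V_{μ₀} = M_q. On
V_{μ₁} the operator xD + (n+2q-2) is an intertwiner into M_q. If it were nonzero it would be
injective with image M_q, and V_{μ₁} would contain a vector of weight q + 1/2, hence a monogenic
one, against directness of the sum.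

For the spinors themselves, the product of all n generators is a scalar by Schur's lemma, so V_Δ
stays irreducible under even products; a vacuum vector, killed by all e_{2j-1} - i e_{2j}, is a
highest weight vector. -/

namespace SpinorHarmonic

/-! ### Commutation relations of D, x, E and the rotations -/

section Operators

variable {n : ℕ} {F : Type*} [AddCommGroup F] [Module ℂ F]

/-- Operators satisfying the Clifford relations `gᵢ gⱼ + gⱼ gᵢ = -2 δᵢⱼ`. -/
def IsCliffordFamily (g : Fin n → Module.End ℂ F) : Prop :=
  ∀ i j v, g i (g j v) = -g j (g i v) + if i = j then (-2 : ℂ) • v else 0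

/-- Operators `Xᵢ`, `dᵢ`, `Gᵢ` satisfying the relations of coordinates, partial derivatives and
Clifford generators. -/
structure WeylClifford (X d G : Fin n → Module.End ℂ F) : Prop where
  X_X : ∀ i j f, X i (X j f) = X j (X i f)
  d_d : ∀ i j f, d i (d j f) = d j (d i f)
  d_X : ∀ i j f, d i (X j f) = X j (d i f) + if i = j then f else 0
  G_X : ∀ i j f, G i (X j f) = X j (G i f)
  G_d : ∀ i j f, G i (d j f) = d j (G i f)
  G_G : ∀ i j f, G i (G j f) = -G j (G i f) + if i = j then (-2 : ℂ) • f else 0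

/-- The Laplacian `∑ dᵢ²`. -/
def lapOp (d : Fin n → Module.End ℂ F) : Module.End ℂ F := ∑ i, d i * d i

/-- The Dirac operator `∑ Gᵢ dᵢ`. -/
def diracOp (d G : Fin n → Module.End ℂ F) : Module.End ℂ F := ∑ i, G i * d i

/-- Multiplication by the vector variable, `∑ Xᵢ Gᵢ`. -/
def vecOp (X G : Fin n → Module.End ℂ F) : Module.End ℂ F := ∑ i, X i * G i

/-- The Euler operator `∑ Xᵢ dᵢ`. -/
def eulerOp (X d : Fin n → Module.End ℂ F) : Module.End ℂ F := ∑ i, X i * d i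

/-- The infinitesimal rotation of the plane of the `k`-th and `l`-th axes. -/
def rotOp (X d G : Fin n → Module.End ℂ F) (k l : Fin n) : Module.End ℂ F :=
  (4 : ℂ) • (X l * d k - X k * d l) + (G k * G l - G l * G k)

/-- The combination `T a + ε T b`. -/
def planeOp (T : Fin n → Module.End ℂ F) (a b : Fin n) (ε : ℂ) : Module.End ℂ F := T a + ε • T b

variable {X d G : Fin n → Module.End ℂ F}

theorem lapOp_apply (f : F) : lapOp d f = ∑ i, d i (d i f) := by simp [lapOp]
theorem diracOp_apply (f : F) : diracOp d G f = ∑ i, G i (d i f) := by simp [diracOp]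
theorem vecOp_apply (f : F) : vecOp X G f = ∑ i, X i (G i f) := by simp [vecOp]
theorem eulerOp_apply (f : F) : eulerOp X d f = ∑ i, X i (d i f) := by simp [eulerOp]
theorem rotOp_apply (k l : Fin n) (f : F) : rotOp X d G k l f =
    (4 : ℂ) • (X l (d k f) - X k (d l f)) + (G k (G l f) - G l (G k f)) := by simp [rotOp]
theorem planeOp_apply (T : Fin n → Module.End ℂ F) (a b : Fin n) (ε : ℂ) (f : F) :
    planeOp T a b ε f = T a f + ε • T b f := by simp [planeOp]

namespace IsCliffordFamily

variable (h : IsCliffordFamily G) {a b : Fin n} {ε : ℂ}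
include h

theorem self (i : Fin n) (f : F) : G i (G i f) = -f := by
  have := h i i f
  rw [if_pos rfl] at this
  have h2 : (2 : ℂ) • G i (G i f) = (2 : ℂ) • (-f) := by
    rw [two_smul]; nth_rewrite 1 [this]; module
  exact smul_right_injective F two_ne_zero h2

theorem anticomm {i j : Fin n} (hij : i ≠ j) (f : F) : G i (G j f) = -G j (G i f) := by
  rw [h i j f, if_neg hij, add_zero]

theorem plane_anticomm {k : Fin n} (ha : k ≠ a) (hb : k ≠ b) (f : F) :
    planeOp G a b ε (G k f) = -G k (planeOp G a b ε f) := by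
  simp only [planeOp_apply, map_add, map_smul, h _ k, if_neg ha.symm, if_neg hb.symm]
  module

theorem plane_plane (hab : a ≠ b) (δ : ℂ) (f : F) : planeOp G a b ε (planeOp G a b δ f) =
    -planeOp G a b δ (planeOp G a b ε f) - (2 * (1 + ε * δ)) • f := by
  simp only [planeOp_apply, map_add, map_smul, h a b, h.self, if_neg hab]
  module

theorem plane_self (hε : ε ^ 2 = -1) (hab : a ≠ b) (f : F) :
    planeOp G a b ε (planeOp G a b ε f) = 0 := by
  simp only [planeOp_apply, map_add, map_smul, h a b, h.self, if_neg hab]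
  rw [show -f + ε • G b (G a f) + ε • (-G b (G a f) + 0 + ε • -f) = -(1 + ε ^ 2) • f by module, hε]
  simp

end IsCliffordFamily

namespace WeylClifford

variable (h : WeylClifford X d G)
include h

theorem isCliffordFamily : IsCliffordFamily G := h.G_G

theorem G_self (i : Fin n) (f : F) : G i (G i f) = -f := h.isCliffordFamily.self i f

theorem dirac_X (k : Fin n) (f : F) :
    diracOp d G (X k f) = X k (diracOp d G f) + G k f := by
  simp only [diracOp_apply, h.d_X, map_add, h.G_X, map_sum, Finset.sum_add_distrib]
  simp [apply_ite]

theorem dirac_d (k : Fin n) (f : F) : diracOp d G (d k f) = d k (diracOp d G f) := by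
  simp [diracOp_apply, h.d_d _ k, h.G_d]

theorem dirac_G (k : Fin n) (f : F) :
    diracOp d G (G k f) = -G k (diracOp d G f) - (2 : ℂ) • d k f := by
  simp only [diracOp_apply, ← h.G_d, h.G_G _ k, Finset.sum_add_distrib, Finset.sum_neg_distrib,
    map_sum]
  simp [sub_eq_add_neg]

theorem vec_X (k : Fin n) (f : F) : vecOp X G (X k f) = X k (vecOp X G f) := by
  simp [vecOp_apply, h.X_X _ k, h.G_X]

theorem vec_d (k : Fin n) (f : F) : vecOp X G (d k f) = d k (vecOp X G f) - G k f := by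
  simp [vecOp_apply, h.d_X, h.G_d, Finset.sum_add_distrib]

theorem vec_G (k : Fin n) (f : F) :
    vecOp X G (G k f) = -G k (vecOp X G f) - (2 : ℂ) • X k f := by
  simp only [vecOp_apply, h.G_G _ k, map_sum, h.G_X, map_add, map_neg, Finset.sum_add_distrib,
    Finset.sum_neg_distrib]
  simp [apply_ite, sub_eq_add_neg]

theorem euler_X (k : Fin n) (f : F) : eulerOp X d (X k f) = X k (eulerOp X d f) + X k f := by
  simp only [eulerOp_apply, h.d_X, map_add, h.X_X _ k, map_sum, Finset.sum_add_distrib]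
  simp [apply_ite]

theorem euler_d (k : Fin n) (f : F) : eulerOp X d (d k f) = d k (eulerOp X d f) - d k f := by
  simp only [eulerOp_apply, h.d_X, h.d_d _ k, map_sum, Finset.sum_add_distrib]
  simp

theorem euler_G (k : Fin n) (f : F) : eulerOp X d (G k f) = G k (eulerOp X d f) := by
  simp [eulerOp_apply, h.G_d, h.G_X]

/-- Moving D through each term G_k d_k of a second D gives D² = -D² - 2Δ. -/
theorem dirac_dirac (f : F) : diracOp d G (diracOp d G f) = -lapOp d f := by
  have key : diracOp d G (diracOp d G f) =
      -diracOp d G (diracOp d G f) - (2 : ℂ) • lapOp d f := by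
    conv_lhs => rw [diracOp_apply (f := f)]
    simp only [map_sum, h.dirac_G, h.dirac_d]
    rw [Finset.sum_sub_distrib, Finset.sum_neg_distrib, ← diracOp_apply, ← Finset.smul_sum,
      lapOp_apply]
  have h2 : (2 : ℂ) • diracOp d G (diracOp d G f) = (2 : ℂ) • (-lapOp d f) := by
    rw [two_smul]; nth_rewrite 1 [key]; module
  exact smul_right_injective F two_ne_zero h2

/-- Each X_k G_k contributes -X_k G_k D - 2 X_k d_k from the two commutators, and G_k² = -1 from the
derivative of X_k; the last terms add up to -n. -/
theorem dirac_vec (f : F) : diracOp d G (vecOp X G f) =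
    -vecOp X G (diracOp d G f) - (2 : ℂ) • eulerOp X d f - (n : ℂ) • f := by
  conv_lhs => rw [vecOp_apply]
  simp only [map_sum, h.dirac_X, h.dirac_G, h.G_self, map_sub, map_neg, map_smul]
  rw [Finset.sum_add_distrib, Finset.sum_sub_distrib, Finset.sum_neg_distrib, ← vecOp_apply,
    ← Finset.smul_sum, ← eulerOp_apply]
  simp [sub_eq_add_neg, Nat.cast_smul_eq_nsmul]

theorem euler_dirac (f : F) :
    eulerOp X d (diracOp d G f) = diracOp d G (eulerOp X d f) - diracOp d G f := by
  conv_lhs => rw [diracOp_apply]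
  simp only [map_sum, h.euler_d, h.euler_G, map_sub]
  rw [Finset.sum_sub_distrib, ← diracOp_apply, ← diracOp_apply]

theorem euler_vec (f : F) :
    eulerOp X d (vecOp X G f) = vecOp X G (eulerOp X d f) + vecOp X G f := by
  conv_lhs => rw [vecOp_apply]
  simp only [map_sum, h.euler_X, h.euler_G]
  rw [Finset.sum_add_distrib, ← vecOp_apply, ← vecOp_apply]

/-- The commutators with the orbital part and with the spin part are opposite; this fixes the factor
4 in `rotOp` relative to the commutator of the G's. -/
theorem dirac_rot (k l : Fin n) (f : F) :
    diracOp d G (rotOp X d G k l f) = rotOp X d G k l (diracOp d G f) := by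
  simp only [rotOp_apply, map_add, map_sub, map_smul, h.dirac_X, h.dirac_d, h.dirac_G, map_neg,
    h.G_d]
  module

theorem vec_rot (k l : Fin n) (f : F) :
    vecOp X G (rotOp X d G k l f) = rotOp X d G k l (vecOp X G f) := by
  simp only [rotOp_apply, map_add, map_sub, map_smul, h.vec_X, h.vec_d, h.vec_G, map_neg,
    h.G_X]
  module

theorem euler_rot (k l : Fin n) (f : F) :
    eulerOp X d (rotOp X d G k l f) = rotOp X d G k l (eulerOp X d f) := by
  simp only [rotOp_apply, map_add, map_sub, map_smul, h.euler_X, h.euler_d, h.euler_G]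
  module

/-- `D x² = x² D - 2 x`. -/
theorem dirac_vec_vec (f : F) : diracOp d G (vecOp X G (vecOp X G f)) =
    vecOp X G (vecOp X G (diracOp d G f)) - (2 : ℂ) • vecOp X G f := by
  simp only [h.dirac_vec, h.euler_vec, map_sub, map_neg, map_smul]
  module

theorem euler_vec_of_eq {f : F} {c : ℂ} (hf : eulerOp X d f = c • f) :
    eulerOp X d (vecOp X G f) = (c + 1) • vecOp X G f := by
  rw [h.euler_vec, hf, map_smul]; module

theorem euler_dirac_of_eq {f : F} {c : ℂ} (hf : eulerOp X d f = c • f) :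
    eulerOp X d (diracOp d G f) = (c - 1) • diracOp d G f := by
  rw [h.euler_dirac, hf, map_smul]; module

end WeylClifford

end Operators

/-! ### Isotropic coordinates in a plane, and monogenics killed by raising operators -/

section Plane

variable {n : ℕ} {F : Type*} [AddCommGroup F] [Module ℂ F] {X d G : Fin n → Module.End ℂ F}

theorem sum_eq_add_add_sum_compl {M : Type*} [AddCommMonoid M] {a b : Fin n} (hab : a ≠ b)
    (φ : Fin n → M) : ∑ i, φ i = φ a + φ b + ∑ k ∈ ({a, b}ᶜ : Finset (Fin n)), φ k := by
  rw [← Finset.sum_add_sum_compl {a, b}, Finset.sum_pair hab]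

/-- The operator `z ∂ + ∑ Xₖ dₖ`, where `z = X a + ε X b`, `∂ = d a - ε d b`, and `k` runs over the
indices other than `a` and `b`. -/
def countOp (X d : Fin n → Module.End ℂ F) (a b : Fin n) (ε : ℂ) : Module.End ℂ F :=
  planeOp X a b ε * planeOp d a b (-ε) + ∑ k ∈ ({a, b}ᶜ : Finset (Fin n)), X k * d k

theorem countOp_apply (a b : Fin n) (ε : ℂ) (f : F) : countOp X d a b ε f =
    planeOp X a b ε (planeOp d a b (-ε) f) +
      ∑ k ∈ ({a, b}ᶜ : Finset (Fin n)), X k (d k f) := by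
  simp [countOp]

theorem eulerOp_eq_plane {a b : Fin n} {ε : ℂ} (hε : ε ^ 2 = -1) (hab : a ≠ b) (f : F) :
    (2 : ℂ) • eulerOp X d f =
    planeOp X a b ε (planeOp d a b (-ε) f) + planeOp X a b (-ε) (planeOp d a b ε f) +
      (2 : ℂ) • ∑ k ∈ ({a, b}ᶜ : Finset (Fin n)), X k (d k f) := by
  rw [eulerOp_apply, sum_eq_add_add_sum_compl hab]
  -- With the relation ε² = -1 inserted by hand, what remains is an identity in ε, which `module`
  -- can check.
  have : (2 : ℂ) • X b (d b f) = (-2 * ε ^ 2) • X b (d b f) := by rw [hε]; norm_num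
  simp only [planeOp_apply, map_add, map_smul, smul_add, this]
  module

theorem diracOp_eq_plane {a b : Fin n} {ε : ℂ} (hε : ε ^ 2 = -1) (hab : a ≠ b) (f : F) :
    (2 : ℂ) • diracOp d G f =
    planeOp G a b ε (planeOp d a b (-ε) f) + planeOp G a b (-ε) (planeOp d a b ε f) +
      (2 : ℂ) • ∑ k ∈ ({a, b}ᶜ : Finset (Fin n)), G k (d k f) := by
  rw [diracOp_apply, sum_eq_add_add_sum_compl hab]
  have : (2 : ℂ) • G b (d b f) = (-2 * ε ^ 2) • G b (d b f) := by rw [hε]; norm_num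
  simp only [planeOp_apply, map_add, map_smul, smul_add, this]
  module

namespace WeylClifford

variable (h : WeylClifford X d G) {a b : Fin n} {ε : ℂ}
include h

theorem plane_X_X (k : Fin n) (f : F) : X k (planeOp X a b ε f) = planeOp X a b ε (X k f) := by
  simp only [planeOp_apply, map_add, map_smul, h.X_X k]

theorem plane_d_d (k : Fin n) (f : F) : d k (planeOp d a b ε f) = planeOp d a b ε (d k f) := by
  simp only [planeOp_apply, map_add, map_smul, h.d_d k]

theorem plane_d_X {k : Fin n} (ha : k ≠ a) (hb : k ≠ b) (f : F) :
    d k (planeOp X a b ε f) = planeOp X a b ε (d k f) := by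
  simp only [planeOp_apply, map_add, map_smul, h.d_X k, if_neg ha, if_neg hb, add_zero]

theorem plane_X_d {k : Fin n} (ha : k ≠ a) (hb : k ≠ b) (f : F) :
    planeOp d a b ε (X k f) = X k (planeOp d a b ε f) := by
  simp only [planeOp_apply, map_add, map_smul, h.d_X _ k, if_neg ha.symm, if_neg hb.symm, add_zero]

theorem plane_plane_d_X (hab : a ≠ b) (δ : ℂ) (f : F) : planeOp d a b ε (planeOp X a b δ f) =
    planeOp X a b δ (planeOp d a b ε f) + (1 + ε * δ) • f := by
  simp only [planeOp_apply, map_add, map_smul, h.d_X, if_neg hab, if_neg hab.symm, if_true]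
  module

theorem plane_G_X (k : Fin n) (f : F) : G k (planeOp X a b ε f) = planeOp X a b ε (G k f) := by
  simp only [planeOp_apply, map_add, map_smul, h.G_X]

theorem G_plane_X (k : Fin n) (f : F) : planeOp G a b ε (X k f) = X k (planeOp G a b ε f) := by
  simp only [planeOp_apply, map_add, map_smul, h.G_X]

theorem G_plane_d (k : Fin n) (f : F) : planeOp G a b ε (d k f) = d k (planeOp G a b ε f) := by
  simp only [planeOp_apply, map_add, map_smul, h.G_d]

theorem plane_plane_G_X (δ : ℂ) (f : F) :
    planeOp G a b ε (planeOp X a b δ f) = planeOp X a b δ (planeOp G a b ε f) := by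
  simp only [planeOp_apply, map_add, map_smul, h.G_X]; module

theorem plane_plane_G_d (δ : ℂ) (f : F) :
    planeOp G a b ε (planeOp d a b δ f) = planeOp d a b δ (planeOp G a b ε f) := by
  simp only [planeOp_apply, map_add, map_smul, h.G_d]; module

theorem G_plane_G {k : Fin n} (ha : k ≠ a) (hb : k ≠ b) (f : F) :
    planeOp G a b ε (G k f) = -G k (planeOp G a b ε f) :=
  h.isCliffordFamily.plane_anticomm ha hb f

theorem plane_plane_G_G (hab : a ≠ b) (δ : ℂ) (f : F) : planeOp G a b ε (planeOp G a b δ f) =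
    -planeOp G a b δ (planeOp G a b ε f) - (2 * (1 + ε * δ)) • f :=
  h.isCliffordFamily.plane_plane hab δ f

theorem plane_G_self (hε : ε ^ 2 = -1) (hab : a ≠ b) (f : F) :
    planeOp G a b ε (planeOp G a b ε f) = 0 :=
  h.isCliffordFamily.plane_self hε hab f

theorem lap_eq_plane (hε : ε ^ 2 = -1) (hab : a ≠ b) (f : F) : lapOp d f =
    planeOp d a b (-ε) (planeOp d a b ε f) +
      ∑ k ∈ ({a, b}ᶜ : Finset (Fin n)), d k (d k f) := by
  rw [lapOp_apply, sum_eq_add_add_sum_compl hab]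
  have : d b (d b f) = (-ε ^ 2) • d b (d b f) := by rw [hε]; norm_num
  simp only [planeOp_apply, map_add, map_smul, h.d_d b a]
  nth_rw 1 [this]
  module

theorem lap_G (k : Fin n) (f : F) : lapOp d (G k f) = G k (lapOp d f) := by
  simp only [lapOp_apply, map_sum, h.G_d]

/-- The action of the root vector `[e_a + ε e_b, e_k]`. -/
theorem rot_plane {k : Fin n} (ha : k ≠ a) (hb : k ≠ b) (f : F) :
    rotOp X d G a k f + ε • rotOp X d G b k f =
      (4 : ℂ) • (X k (planeOp d a b ε f) - planeOp X a b ε (d k f)) -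
        (2 : ℂ) • G k (planeOp G a b ε f) := by
  simp only [rotOp_apply, planeOp_apply, map_add, map_smul, h.G_G _ k, if_neg ha.symm,
    if_neg hb.symm]
  module

/-- A monogenic `f` annihilated by the root vectors `[e_a + ε e_b, e_k]`, where `ε² = -1`, only
depends on `X a + ε X b`, and is annihilated by `G a + ε G b`. -/
theorem eq_zero_of_rot_plane (hab : a ≠ b) (hε : ε ^ 2 = -1)
    (hX : Function.Injective (planeOp X a b ε))
    (hN : ∀ u, countOp X d a b ε u + ((n - 2 : ℕ) : ℂ) • u = 0 → u = 0)
    {f : F} (hD : diracOp d G f = 0)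
    (hf : ∀ k, k ≠ a → k ≠ b → rotOp X d G a k f + ε • rotOp X d G b k f = 0) :
    planeOp d a b ε f = 0 ∧ planeOp G a b ε f = 0 ∧ ∀ k, k ≠ a → k ≠ b → d k f = 0 := by
  have hmem : ∀ k ∈ ({a, b}ᶜ : Finset (Fin n)), k ≠ a ∧ k ≠ b := by simp
  have hcard : ({a, b}ᶜ : Finset (Fin n)).card = n - 2 := by
    rw [Finset.card_compl, Finset.card_pair hab, Fintype.card_fin]
  have hX0 : ∀ u, planeOp X a b ε u = 0 → u = 0 := fun u hu => hX (by simpa using hu)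
  -- Notation for the steps below: z = X a + ε X b, ∂ = d a + ε d b, ∂̄ = d a - ε d b, Γ = G a + ε G
  -- b, Γ̄ = G a - ε G b, and g = Γf. Here ∂z = z∂ and Γ² = 0, since ε² = -1.
  obtain ⟨g, hg⟩ : ∃ g, planeOp G a b ε f = g := ⟨_, rfl⟩
  have hgg : planeOp G a b ε g = 0 := by rw [← hg, h.plane_G_self hε hab]
  have h1 : ∀ k, k ≠ a → k ≠ b →
      G k g = (2 : ℂ) • (X k (planeOp d a b ε f) - planeOp X a b ε (d k f)) := by
    intro k ha hb
    have := hf k ha hb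
    rw [h.rot_plane ha hb, hg] at this
    have h2 : (2 : ℂ) • G k g =
        (2 : ℂ) • (2 : ℂ) • (X k (planeOp d a b ε f) - planeOp X a b ε (d k f)) := by
      rw [← sub_eq_zero.1 this]; module
    exact smul_right_injective F two_ne_zero h2
  -- Apply Γ to `h1`: the left side dies because Γ anticommutes with G k and Γg = 0.
  have h2 : ∀ k, k ≠ a → k ≠ b → X k (planeOp d a b ε g) = planeOp X a b ε (d k g) := by
    intro k ha hb
    have := congrArg (planeOp G a b ε) (h1 k ha hb)
    rw [h.G_plane_G ha hb, hgg, map_zero, neg_zero, map_smul, map_sub,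
      h.G_plane_X, h.plane_plane_G_d, h.plane_plane_G_X, h.G_plane_d, hg] at this
    exact sub_eq_zero.1 ((smul_eq_zero.1 this.symm).resolve_left two_ne_zero)
  -- g is harmonic. Multiplying ∂̄∂g + ∑ d_k² g = 0 by z and replacing z d_k g by X_k ∂g yields
  -- (count + n - 2) ∂g = 0, and `hN` applies.
  have h3 : planeOp d a b ε g = 0 := by
    have hlap : lapOp d g = 0 := by
      rw [← hg, planeOp_apply, map_add, map_smul, h.lap_G, h.lap_G, ← neg_neg (lapOp d f),
        ← h.dirac_dirac, hD]
      simp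
    have := congrArg (planeOp X a b ε) hlap
    rw [h.lap_eq_plane hε hab, map_add, map_sum, map_zero, Finset.sum_congr rfl
      (g := fun k => X k (d k (planeOp d a b ε g)) + planeOp d a b ε g), Finset.sum_add_distrib,
      Finset.sum_const, hcard, ← add_assoc, ← countOp_apply] at this
    · exact hN _ (by rw [Nat.cast_smul_eq_nsmul]; exact this)
    · intro k hk
      obtain ⟨ha, hb⟩ := hmem k hk
      rw [← h.plane_d_X ha hb, ← h2 k ha hb, h.d_X, if_pos rfl]
  have h4 : ∀ k, k ≠ a → k ≠ b → d k g = 0 := fun k ha hb =>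
    hX0 _ (by rw [← h2 k ha hb, h3, map_zero])
  -- This is 2zDf = 0 written in isotropic coordinates, with z d_k f eliminated by `h1`. Each of the
  -- n - 2 indices k gives one copy of g, because G_k² = -1.
  have h5 : planeOp X a b ε (planeOp G a b (-ε) (planeOp d a b ε f)) +
      (planeOp X a b ε (planeOp d a b (-ε) g) + ((n - 2 : ℕ) : ℂ) • g) +
      (2 : ℂ) • ∑ k ∈ ({a, b}ᶜ : Finset (Fin n)), X k (G k (planeOp d a b ε f)) = 0 := by
    have := congrArg (fun u => planeOp X a b ε ((2 : ℂ) • u)) hD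
    simp only [diracOp_eq_plane hε hab, map_add, map_smul, map_sum, map_zero, smul_zero] at this
    rw [Finset.sum_congr rfl
      (g := fun k => X k (G k (planeOp d a b ε f)) + (1 / 2 : ℂ) • g), Finset.sum_add_distrib,
      Finset.sum_const, hcard, h.plane_plane_G_d, hg, ← Nat.cast_smul_eq_nsmul ℂ] at this
    · rw [← this]; module
    · intro k hk
      obtain ⟨ha, hb⟩ := hmem k hk
      have := congrArg (G k) (h1 k ha hb)
      rw [h.G_self, map_smul, map_sub, h.G_X, h.plane_G_X] at this
      rw [← neg_neg g, this]
      module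
  -- Apply Γ to `h5`: only ΓΓ̄∂f = -4∂f survives, because Γ kills g and Γ∂f = ∂g = 0.
  have h6 : planeOp d a b ε f = 0 := by
    have e1 : planeOp G a b ε (planeOp G a b (-ε) (planeOp d a b ε f)) =
        -(4 : ℂ) • planeOp d a b ε f := by
      rw [h.plane_plane_G_G hab, h.plane_plane_G_d, hg, h3, map_zero, neg_zero, zero_sub,
        show 2 * (1 + ε * -ε) = 2 * (1 - ε ^ 2) by ring, hε]
      module
    have := congrArg (planeOp G a b ε) h5
    rw [map_add, map_add, map_add, map_smul, map_smul, map_sum, map_zero, hgg, h.plane_plane_G_X,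
      h.plane_plane_G_X, e1, h.plane_plane_G_d, hgg, Finset.sum_eq_zero, smul_zero, smul_zero,
      add_zero, map_zero, map_zero, add_zero, add_zero] at this
    · exact (smul_eq_zero.1 (hX0 _ this)).resolve_left (by norm_num)
    · intro k hk
      obtain ⟨ha, hb⟩ := hmem k hk
      rw [h.G_plane_X, h.G_plane_G ha hb, h.plane_plane_G_d, hg, h3, map_zero, neg_zero, map_zero]
  -- With ∂f = 0, `h5` reduces to (z∂̄ + n - 2) g = 0, and z∂̄ is the count operator on g since d_k
  -- g = 0.
  have h7 : g = 0 := by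
    rw [h6, map_zero, map_zero, zero_add, Finset.sum_eq_zero (fun k _ => by simp), smul_zero,
      add_zero] at h5
    refine hN _ ?_
    rw [countOp_apply, Finset.sum_eq_zero (fun k hk => by
      rw [h4 k (hmem k hk).1 (hmem k hk).2, map_zero]), add_zero]
    exact h5
  refine ⟨h6, hg.trans h7, fun k ha hb => hX0 _ ?_⟩
  have := h1 k ha hb
  rw [h7, h6, map_zero, map_zero, zero_sub] at this
  simpa using this.symm

end WeylClifford

end Plane

/-! ### Vectors killed by raising operators -/

section Raising

variable {F : Type*} [AddCommGroup F] [Module ℂ F]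

/-- Operators `E i` that shift the eigenvalues of `L` by `c ≠ 0` have a common kernel on every
nonzero finite-dimensional invariant subspace. -/
theorem exists_ne_zero_forall_eq_zero {ι : Type*} {W : Submodule ℂ F} [FiniteDimensional ℂ W]
    (hW : W ≠ ⊥) {L : Module.End ℂ F} {E : ι → Module.End ℂ F} {c : ℂ} (hc : c ≠ 0)
    (hL : ∀ w ∈ W, L w ∈ W) (hE : ∀ i, ∀ w ∈ W, E i w ∈ W)
    (hLE : ∀ i f, L (E i f) = E i (L f) + c • E i f) :
    ∃ w ∈ W, w ≠ 0 ∧ ∀ i, E i w = 0 := by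
  have : Nontrivial W := Submodule.nontrivial_iff_ne_bot.2 hW
  let L' : Module.End ℂ W := L.restrict hL
  obtain ⟨μ₀, hμ₀⟩ := Module.End.exists_eigenvalue L'
  have hfin : {μ | L'.HasEigenvalue μ}.Finite := Module.End.finite_hasEigenvalue L'
  -- Take the eigenvalue with the largest real part of μ/c; a nonzero E i w would have eigenvalue μ
  -- + c, whose value is larger by 1.
  obtain ⟨μ, hμ, hmax⟩ := Set.exists_max_image _ (fun μ : ℂ => (μ / c).re) hfin ⟨μ₀, hμ₀⟩
  obtain ⟨w, hw⟩ := Module.End.HasEigenvalue.exists_hasEigenvector hμ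
  have hLw : L w = μ • (w : F) := congrArg Subtype.val hw.apply_eq_smul
  refine ⟨w, w.2, fun h => hw.2 (Subtype.ext h), fun i => ?_⟩
  by_contra hne
  have hev : L'.HasEigenvalue (μ + c) := by
    refine Module.End.hasEigenvalue_of_hasEigenvector (x := ⟨E i w, hE i w w.2⟩) ⟨?_, ?_⟩
    · refine Module.End.mem_eigenspace_iff.2 (Subtype.ext ?_)
      change L (E i w) = (μ + c) • E i (w : F)
      rw [hLE, hLw, map_smul, add_smul]
    · exact fun h => hne (congrArg Subtype.val h)
  have := hmax _ hev
  rw [add_div, div_self hc, Complex.add_re, Complex.one_re] at this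
  linarith

end Raising

/-! ### Weights of the rotation in one plane -/

section Weights

variable {n : ℕ} {F : Type*} [AddCommGroup F] [Module ℂ F] {X d G : Fin n → Module.End ℂ F}

/-- The count operator is the degree plus the orbital weight, so its positivity on polynomials
bounds the orbital weight by the degree. -/
theorem countOp_eq_eulerOp_add {a b : Fin n} {ε : ℂ} (hε : ε ^ 2 = -1) (hab : a ≠ b) (f : F) :
    countOp X d a b ε f = eulerOp X d f + ε • (X b (d a f) - X a (d b f)) := by
  rw [eulerOp_apply, sum_eq_add_add_sum_compl hab, countOp_apply]
  have : X b (d b f) = (-ε ^ 2) • X b (d b f) := by rw [hε]; norm_num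
  simp only [planeOp_apply, map_add, map_smul]
  nth_rw 2 [this]
  module

namespace WeylClifford

variable (h : WeylClifford X d G) {a b : Fin n} {ε : ℂ}
include h

theorem rot_comm_X {k : Fin n} (ha : k ≠ a) (hb : k ≠ b) (f : F) :
    rotOp X d G a b (X k f) = X k (rotOp X d G a b f) := by
  simp only [rotOp_apply, h.d_X, if_neg ha.symm, if_neg hb.symm, h.G_X, h.X_X _ k, map_add,
    map_sub, map_smul, add_zero]

theorem rot_comm_d {k : Fin n} (ha : k ≠ a) (hb : k ≠ b) (f : F) :
    rotOp X d G a b (d k f) = d k (rotOp X d G a b f) := by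
  simp only [rotOp_apply, h.d_X, if_neg ha, if_neg hb, h.G_d, h.d_d _ k, map_add,
    map_sub, map_smul, add_zero]

theorem rot_comm_G {k : Fin n} (ha : k ≠ a) (hb : k ≠ b) (f : F) :
    rotOp X d G a b (G k f) = G k (rotOp X d G a b f) := by
  simp only [rotOp_apply, h.G_X, h.G_d, h.G_G _ k, if_neg ha.symm, if_neg hb.symm, map_add,
    map_sub, map_smul, map_neg, add_zero, neg_neg]

theorem rot_plane_X (hε : ε ^ 2 = -1) (hab : a ≠ b) (f : F) :
    rotOp X d G a b (planeOp X a b ε f) =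
      planeOp X a b ε (rotOp X d G a b f) + (-4 * ε) • planeOp X a b ε f := by
  simp only [rotOp_apply, planeOp_apply, h.d_X, h.G_X, map_add, map_sub, map_smul, if_neg hab,
    if_neg hab.symm, if_true, h.X_X b a, add_zero]
  have h2 : X b f = (-ε ^ 2) • X b f := by rw [hε]; norm_num
  linear_combination (norm := module) (4 : ℂ) • h2

theorem rot_plane_d (hε : ε ^ 2 = -1) (hab : a ≠ b) (f : F) :
    rotOp X d G a b (planeOp d a b ε f) =
      planeOp d a b ε (rotOp X d G a b f) + (-4 * ε) • planeOp d a b ε f := by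
  simp only [rotOp_apply, planeOp_apply, h.d_X, h.G_d, map_add, map_sub, map_smul, if_neg hab,
    if_neg hab.symm, if_true, h.d_d b a]
  have h2 : d b f = (-ε ^ 2) • d b f := by rw [hε]; norm_num
  linear_combination (norm := module) (4 : ℂ) • h2

theorem rot_plane_G (hε : ε ^ 2 = -1) (hab : a ≠ b) (f : F) :
    rotOp X d G a b (planeOp G a b ε f) =
      planeOp G a b ε (rotOp X d G a b f) + (-4 * ε) • planeOp G a b ε f := by
  simp only [rotOp_apply, planeOp_apply, h.G_d, h.G_X, map_add, map_sub, map_smul, h.G_G a b,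
    if_neg hab, map_neg, h.G_self, add_zero]
  have h2 : G b f = (-ε ^ 2) • G b f := by rw [hε]; norm_num
  linear_combination (norm := module) (4 : ℂ) • h2

/-- Each term of `rot_plane` has exactly one factor combined from the plane of a and b, which shifts
by -4ε, while its other factor commutes with the rotation. -/
theorem rot_rot_plane (hε : ε ^ 2 = -1) (hab : a ≠ b) {k : Fin n} (ha : k ≠ a) (hb : k ≠ b)
    (f : F) : rotOp X d G a b ((rotOp X d G a k + ε • rotOp X d G b k) f) =
      (rotOp X d G a k + ε • rotOp X d G b k) (rotOp X d G a b f) +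
        (-4 * ε) • (rotOp X d G a k + ε • rotOp X d G b k) f := by
  simp only [LinearMap.add_apply, LinearMap.smul_apply, h.rot_plane ha hb, map_sub, map_smul,
    h.rot_comm_X ha hb, h.rot_comm_G ha hb, h.rot_plane_X hε hab, h.rot_comm_d ha hb,
    h.rot_plane_d hε hab, h.rot_plane_G hε hab, map_add]
  module

theorem rot_G_G (hab : a ≠ b) (f : F) :
    rotOp X d G a b (G a (G b f)) = G a (G b (rotOp X d G a b f)) := by
  simp only [rotOp_apply, h.G_X, h.G_d, map_add, map_sub, map_smul, h.G_G b a, if_neg hab.symm,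
    h.G_self, map_neg, add_zero, neg_neg]

/-- On polynomials of degree `p`, the weights are at most `p + 1/2`. -/
theorem eq_zero_of_weight (hab : a ≠ b)
    (hN : ∀ c : ℝ, 0 < c → ∀ u, countOp X d a b Complex.I u + (c : ℂ) • u = 0 → u = 0)
    {p μ : ℝ} (hμ : p + 1 / 2 < μ) {f : F} (hE : eulerOp X d f = (p : ℂ) • f)
    (hL : rotOp X d G a b f = (4 * Complex.I * μ) • f) : f = 0 := by
  -- Since (G a G b)² = -1, f splits into eigenvectors of G a G b with eigenvalues ±i. The vector u
  -- below has eigenvalue s i, so its spin weight is s/2 and its orbital weight is μ - s/2 > p,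
  -- which the count operator forbids.
  have key : ∀ s : ℝ, s ^ 2 = 1 → f - (s * Complex.I) • G a (G b f) = 0 := by
    intro s hs
    have hs' : (s : ℂ) ^ 2 = 1 := by exact_mod_cast hs
    have hs1 : s ≤ 1 := by nlinarith
    obtain ⟨u, hu⟩ : ∃ u, f - (s * Complex.I) • G a (G b f) = u := ⟨_, rfl⟩
    have hEu : eulerOp X d u = (p : ℂ) • u := by
      rw [← hu, map_sub, map_smul, h.euler_G, h.euler_G, hE, map_smul, map_smul]; module
    have hLu : rotOp X d G a b u = (4 * Complex.I * μ) • u := by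
      rw [← hu, map_sub, map_smul, h.rot_G_G hab, hL, map_smul, map_smul]; module
    have hGu : G a (G b u) = (s * Complex.I) • u := by
      have hab' : G a (G b (G a (G b f))) = -f := by
        rw [h.G_G b a, if_neg hab.symm, add_zero, map_neg, h.G_self, h.G_self, neg_neg]
      rw [← hu, map_sub, map_sub, map_smul, map_smul, hab']
      have : (s * Complex.I) * (s * Complex.I) = -1 := by
        rw [mul_mul_mul_comm, Complex.I_mul_I, ← sq, hs']; ring
      rw [smul_sub, smul_smul, this]; module
    rw [hu]
    refine hN (μ - s / 2 - p) (by linarith) u ?_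
    rw [rotOp_apply, h.G_G b a, if_neg hab.symm, hGu] at hLu
    rw [countOp_eq_eulerOp_add Complex.I_sq hab, hEu]
    have h4 : X b (d a u) - X a (d b u) = (Complex.I * (μ - s / 2)) • u := by
      refine smul_right_injective F (show (4 : ℂ) ≠ 0 by norm_num) ?_
      change (4 : ℂ) • (X b (d a u) - X a (d b u)) = (4 : ℂ) • (Complex.I * (μ - s / 2)) • u
      linear_combination (norm := module) hLu
    rw [h4, smul_smul, ← mul_assoc, Complex.I_mul_I]
    push_cast
    module
  have h1 := key 1 (by norm_num)
  have h2 := key (-1) (by norm_num)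
  have : (2 : ℂ) • f = 0 := by
    push_cast at h1 h2
    linear_combination (norm := module) h1 + h2
  exact (smul_eq_zero.1 this).resolve_left two_ne_zero

end WeylClifford

end Weights

/-! ### Fischer decomposition into powers of x times monogenics -/

section Fischer

variable {n : ℕ} {F : Type*} [AddCommGroup F] [Module ℂ F] {X d G : Fin n → Module.End ℂ F}

/-- The sum of the spaces `xʲ m`, with `m` monogenic of degree `p`, for `j + p = q`. -/
def fischerSpan (X d G : Fin n → Module.End ℂ F) (q : ℕ) : Submodule ℂ F :=
  Submodule.span ℂ {f | ∃ (j p : ℕ) (m : F), j + p = q ∧ diracOp d G m = 0 ∧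
    eulerOp X d m = (p : ℂ) • m ∧ (vecOp X G ^ j) m = f}

namespace WeylClifford

variable (h : WeylClifford X d G)
include h

theorem euler_vec_pow {f : F} {c : ℂ} (hf : eulerOp X d f = c • f) (j : ℕ) :
    eulerOp X d ((vecOp X G ^ j) f) = (c + j) • (vecOp X G ^ j) f := by
  induction j with
  | zero => simpa using hf
  | succ j ih =>
    rw [pow_succ', Module.End.mul_apply, h.euler_vec_of_eq ih]
    push_cast
    module

/-- The form -(r + 1) with r natural records that the scalar is nonzero. It is -(n + 2p) for j = 0
and -2 for j = 1, and the relation Dx² = x²D - 2x lowers it by 2 every two steps. -/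
theorem dirac_vec_pow (hn : 0 < n) {m : F} {p : ℕ} (hD : diracOp d G m = 0)
    (hE : eulerOp X d m = (p : ℂ) • m) (j : ℕ) : ∃ r : ℕ,
      diracOp d G ((vecOp X G ^ (j + 1)) m) = (-(r + 1 : ℂ)) • (vecOp X G ^ j) m := by
  induction j using Nat.twoStepInduction with
  | zero =>
    refine ⟨n + 2 * p - 1, ?_⟩
    rw [zero_add, pow_one, h.dirac_vec, hD, hE, Nat.cast_sub (by omega)]
    push_cast
    rw [pow_zero, Module.End.one_apply, map_zero]
    module
  | one =>
    refine ⟨1, ?_⟩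
    rw [pow_succ', pow_one, Module.End.mul_apply, h.dirac_vec_vec, hD]
    simp
    norm_num
  | more j ih _ =>
    obtain ⟨r, hr⟩ := ih
    refine ⟨r + 2, ?_⟩
    rw [pow_succ' _ (j + 2), pow_succ' _ (j + 1), Module.End.mul_apply, Module.End.mul_apply,
      h.dirac_vec_vec, hr, map_smul, map_smul, ← Module.End.mul_apply, ← Module.End.mul_apply,
      ← Module.End.mul_apply, mul_assoc, ← pow_succ', ← pow_succ']
    push_cast
    module

/-- Since D x^{j+1} m is a nonzero multiple of x^j m, D can be inverted term by term on sums of such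
elements. -/
theorem exists_dirac_vec_eq (hn : 0 < n) {q : ℕ} {g : F} (hg : g ∈ fischerSpan X d G q) :
    ∃ u, eulerOp X d u = (q : ℂ) • u ∧ diracOp d G (vecOp X G u) = g ∧
      vecOp X G u ∈ fischerSpan X d G (q + 1) := by
  induction hg using Submodule.span_induction with
  | zero => exact ⟨0, by simp, by simp, by simp⟩
  | add g₁ g₂ _ _ h₁ h₂ =>
    obtain ⟨u₁, e₁, d₁, s₁⟩ := h₁
    obtain ⟨u₂, e₂, d₂, s₂⟩ := h₂
    refine ⟨u₁ + u₂, by rw [map_add, e₁, e₂, smul_add], by rw [map_add, map_add, d₁, d₂], ?_⟩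
    rw [map_add]
    exact Submodule.add_mem _ s₁ s₂
  | smul c g _ h₁ =>
    obtain ⟨u₁, e₁, d₁, s₁⟩ := h₁
    refine ⟨c • u₁, by rw [map_smul, e₁, smul_comm], by rw [map_smul, map_smul, d₁], ?_⟩
    rw [map_smul]
    exact Submodule.smul_mem _ _ s₁
  | mem g hg =>
    obtain ⟨j, p, m, hjp, hD, hE, rfl⟩ := hg
    obtain ⟨r, hr⟩ := h.dirac_vec_pow hn hD hE j
    have hr0 : (-(r + 1 : ℂ)) ≠ 0 := neg_ne_zero.2 (Nat.cast_add_one_ne_zero r)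
    refine ⟨(-(r + 1 : ℂ))⁻¹ • (vecOp X G ^ j) m, ?_, ?_, ?_⟩
    · rw [map_smul, h.euler_vec_pow hE, ← hjp, smul_comm]
      push_cast
      rw [add_comm]
    · rw [map_smul, map_smul, ← Module.End.mul_apply (vecOp X G), ← pow_succ', hr, smul_smul,
        inv_mul_cancel₀ hr0, one_smul]
    · rw [map_smul, ← Module.End.mul_apply, ← pow_succ']
      exact Submodule.smul_mem _ _ (Submodule.subset_span ⟨j + 1, p, m, by omega, hD, hE, rfl⟩)

/-- Induction on the degree: Df lies in the span one degree lower, so Df = Dxu for some u, and f -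
xu is monogenic. -/
theorem mem_fischerSpan (hn : 0 < n) (hneg : ∀ u : F, eulerOp X d u = -u → u = 0) {q : ℕ} {f : F}
    (hE : eulerOp X d f = (q : ℂ) • f) : f ∈ fischerSpan X d G q := by
  induction q generalizing f with
  | zero =>
    refine Submodule.subset_span ⟨0, 0, f, rfl, hneg _ ?_, hE, by simp⟩
    rw [h.euler_dirac_of_eq hE]
    simp
  | succ q ih =>
    have hD := ih (f := diracOp d G f) (by rw [h.euler_dirac_of_eq hE]; push_cast; module)
    obtain ⟨u, hEu, hDu, hu⟩ := h.exists_dirac_vec_eq hn hD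
    have : f - vecOp X G u ∈ fischerSpan X d G (q + 1) := by
      refine Submodule.subset_span ⟨0, q + 1, _, by simp, ?_, ?_, by simp; rfl⟩
      · rw [map_sub, hDu, sub_self]
      · rw [map_sub, hE, h.euler_vec_of_eq hEu, smul_sub]
        push_cast
        rfl
    simpa using Submodule.add_mem _ this hu

/-- The Fischer decomposition: a polynomial of degree `q` is monogenic modulo multiples of `x`. -/
theorem exists_dirac_sub_vec (hn : 0 < n) (hneg : ∀ u : F, eulerOp X d u = -u → u = 0) {q : ℕ}
    {f : F} (hE : eulerOp X d f = (q : ℂ) • f) : ∃ u, diracOp d G (f - vecOp X G u) = 0 ∧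
      eulerOp X d (f - vecOp X G u) = (q : ℂ) • (f - vecOp X G u) := by
  cases q with
  | zero =>
    refine ⟨0, ?_, by simpa using hE⟩
    rw [map_zero, sub_zero]
    refine hneg _ ?_
    rw [h.euler_dirac_of_eq hE]
    simp
  | succ q =>
    have hD := h.mem_fischerSpan hn hneg (q := q) (f := diracOp d G f)
      (by rw [h.euler_dirac_of_eq hE]; push_cast; module)
    obtain ⟨u, hEu, hDu, -⟩ := h.exists_dirac_vec_eq hn hD
    refine ⟨u, by rw [map_sub, hDu, sub_self], ?_⟩
    rw [map_sub, hE, h.euler_vec_of_eq hEu, smul_sub]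
    push_cast
    rfl

end WeylClifford

end Fischer

/-! ### The polynomial model: positivity, homogeneity, harmonics -/

section Polynomials

variable {n : ℕ} {V : Type*} [AddCommGroup V] [Module ℂ V]

/-- Multiplication by `Xᵢ` on `V`-valued polynomials. -/
noncomputable def tX (V : Type*) [AddCommGroup V] [Module ℂ V] (i : Fin n) :
    Module.End ℂ (MvPolynomial (Fin n) ℂ ⊗[ℂ] V) :=
  (LinearMap.mulLeft ℂ (MvPolynomial.X i)).rTensor V

/-- The `i`-th partial derivative on `V`-valued polynomials. -/
noncomputable def tD (V : Type*) [AddCommGroup V] [Module ℂ V] (i : Fin n) :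
    Module.End ℂ (MvPolynomial (Fin n) ℂ ⊗[ℂ] V) :=
  (MvPolynomial.pderiv i).toLinearMap.rTensor V

/-- The operator `gᵢ` applied to the values of `V`-valued polynomials. -/
noncomputable def tG (g : Fin n → Module.End ℂ V) (i : Fin n) :
    Module.End ℂ (MvPolynomial (Fin n) ℂ ⊗[ℂ] V) :=
  (g i).lTensor (MvPolynomial (Fin n) ℂ)

@[simp] theorem tX_tmul (i : Fin n) (p : MvPolynomial (Fin n) ℂ) (v : V) :
    tX V i (p ⊗ₜ v) = (MvPolynomial.X i * p) ⊗ₜ v := rfl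

@[simp] theorem tD_tmul (i : Fin n) (p : MvPolynomial (Fin n) ℂ) (v : V) :
    tD V i (p ⊗ₜ v) = (MvPolynomial.pderiv i p) ⊗ₜ v := rfl

@[simp] theorem tG_tmul (g : Fin n → Module.End ℂ V) (i : Fin n) (p : MvPolynomial (Fin n) ℂ)
    (v : V) : tG g i (p ⊗ₜ v) = p ⊗ₜ g i v := rfl

theorem pderiv_comm (i j : Fin n) (p : MvPolynomial (Fin n) ℂ) :
    MvPolynomial.pderiv i (MvPolynomial.pderiv j p) =
      MvPolynomial.pderiv j (MvPolynomial.pderiv i p) := by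
  ext s
  rw [MvPolynomial.coeff_pderiv, MvPolynomial.coeff_pderiv, MvPolynomial.coeff_pderiv,
    MvPolynomial.coeff_pderiv, add_right_comm s]
  by_cases hij : i = j
  · rw [hij]
  · simp [hij, Ne.symm hij, mul_right_comm]

theorem IsCliffordFamily.weylClifford {g : Fin n → Module.End ℂ V} (hg : IsCliffordFamily g) :
    WeylClifford (tX V) (tD V) (tG g) where
  X_X i j f := by
    induction f with
    | zero => simp
    | add f₁ f₂ h₁ h₂ => simp only [map_add, h₁, h₂]
    | tmul p v => simp [mul_left_comm]
  d_d i j f := by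
    induction f with
    | zero => simp
    | add f₁ f₂ h₁ h₂ => simp only [map_add, h₁, h₂]
    | tmul p v => simp [pderiv_comm i j]
  d_X i j f := by
    induction f with
    | zero => simp
    | add f₁ f₂ h₁ h₂ => simp only [map_add, h₁, h₂]; split_ifs <;> abel
    | tmul p v =>
      rw [tX_tmul, tD_tmul, Derivation.leibniz, tD_tmul, tX_tmul, MvPolynomial.pderiv_X,
        TensorProduct.add_tmul, smul_eq_mul, smul_eq_mul, Pi.single_apply]
      split_ifs with h1 h2 h2
      · rw [mul_one]
      · exact absurd h1.symm h2
      · exact absurd h2.symm h1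
      · rw [mul_zero, TensorProduct.zero_tmul]
  G_X i j f := by
    induction f with
    | zero => simp
    | add f₁ f₂ h₁ h₂ => simp only [map_add, h₁, h₂]
    | tmul p v => simp
  G_d i j f := by
    induction f with
    | zero => simp
    | add f₁ f₂ h₁ h₂ => simp only [map_add, h₁, h₂]
    | tmul p v => simp
  G_G i j f := by
    induction f with
    | zero => simp
    | add f₁ f₂ h₁ h₂ => simp only [map_add, h₁, h₂]; split_ifs <;> module
    | tmul p v =>
      simp only [tG_tmul, hg i j v, TensorProduct.tmul_add, TensorProduct.tmul_neg]
      split_ifs <;> simp only [TensorProduct.tmul_smul, TensorProduct.tmul_zero]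

/-- The `V`-valued polynomials are generated by the constants. -/
theorem eq_top_of_tX_mem {S : Submodule ℂ (MvPolynomial (Fin n) ℂ ⊗[ℂ] V)}
    (h1 : ∀ v : V, 1 ⊗ₜ[ℂ] v ∈ S) (hX : ∀ i, ∀ f ∈ S, tX V i f ∈ S) : S = ⊤ := by
  refine Submodule.eq_top_iff'.2 fun f => ?_
  induction f with
  | zero => exact S.zero_mem
  | add f₁ f₂ h₁ h₂ => exact S.add_mem h₁ h₂
  | tmul p v =>
    induction p using MvPolynomial.induction_on with
    | C a =>
      rw [← mul_one (MvPolynomial.C a), ← MvPolynomial.smul_eq_C_mul, ← TensorProduct.smul_tmul']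
      exact S.smul_mem a (h1 v)
    | add p q hp hq => rw [TensorProduct.add_tmul]; exact S.add_mem hp hq
    | mul_X p i hp => rw [mul_comm, ← tX_tmul]; exact hX i _ hp

theorem eq_zero_of_iSup_eigenspace {F : Type*} [AddCommGroup F] [Module ℂ F] {T : Module.End ℂ F}
    (hT : ⨆ k : ℕ, T.eigenspace (k : ℂ) = ⊤) {c : ℝ} (hc : 0 < c) {u : F}
    (hu : T u + (c : ℂ) • u = 0) : u = 0 := by
  have h1 : u ∈ T.eigenspace (-c : ℂ) := by
    rw [Module.End.mem_eigenspace_iff, eq_neg_of_add_eq_zero_left hu, neg_smul]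
  have h2 := (T.eigenspaces_iSupIndep) (-c : ℂ)
  -- No natural number equals -c, so the eigenspaces for natural eigenvalues all lie in the sum from
  -- which the one for -c is independent.
  have h3 : ⨆ k : ℕ, T.eigenspace (k : ℂ) ≤ ⨆ (j) (_ : j ≠ (-c : ℂ)), T.eigenspace j := by
    refine iSup_le fun k => le_iSup₂_of_le (k : ℂ) ?_ le_rfl
    intro h
    have : (k : ℝ) = -c := by exact_mod_cast h
    have := Nat.cast_nonneg (α := ℝ) k
    linarith
  rw [hT, top_le_iff] at h3
  rw [h3, disjoint_top] at h2
  rw [h2] at h1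
  exact (Submodule.mem_bot ℂ).1 h1

theorem mem_iSup_eigenspace_of_shift {F : Type*} [AddCommGroup F] [Module ℂ F]
    {T Y : Module.End ℂ F} (r : ℕ) (h : ∀ f, T (Y f) = Y (T f) + (r : ℂ) • Y f) {f : F}
    (hf : f ∈ ⨆ k : ℕ, T.eigenspace (k : ℂ)) : Y f ∈ ⨆ k : ℕ, T.eigenspace (k : ℂ) := by
  have : ⨆ k : ℕ, T.eigenspace (k : ℂ) ≤ (⨆ k : ℕ, T.eigenspace (k : ℂ)).comap Y := by
    refine iSup_le fun k f hf => ?_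
    rw [Module.End.mem_eigenspace_iff] at hf
    refine Submodule.mem_iSup_of_mem (k + r) ?_
    rw [Module.End.mem_eigenspace_iff, h, hf, map_smul]
    push_cast
    module
  exact this hf

variable {g : Fin n → Module.End ℂ V}

theorem iSup_eigenspace_eulerOp (hg : IsCliffordFamily g) :
    ⨆ k : ℕ, (eulerOp (tX V) (tD V) : Module.End ℂ (MvPolynomial (Fin n) ℂ ⊗[ℂ] V)).eigenspace
      (k : ℂ) = ⊤ := by
  refine eq_top_of_tX_mem (fun v => Submodule.mem_iSup_of_mem 0 ?_) fun i f hf =>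
    mem_iSup_eigenspace_of_shift 1 (fun f => ?_) hf
  · simp [eulerOp_apply]
  · rw [hg.weylClifford.euler_X]; simp

/-- Constants have count 0, and multiplication by X a + ε X b, by X a - ε X b and by the other X k
raises the count by 2, 0 and 1. So every eigenvalue is a natural number. -/
theorem iSup_eigenspace_countOp (hg : IsCliffordFamily g) {a b : Fin n} (hab : a ≠ b) {ε : ℂ}
    (hε : ε ^ 2 = -1) : ⨆ k : ℕ, (countOp (tX V) (tD V) a b ε :
      Module.End ℂ (MvPolynomial (Fin n) ℂ ⊗[ℂ] V)).eigenspace (k : ℂ) = ⊤ := by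
  have h := hg.weylClifford
  have hε0 : ε ≠ 0 := by rintro rfl; norm_num at hε
  have hz : ∀ f ∈ ⨆ k : ℕ, (countOp (tX V) (tD V) a b ε).eigenspace (k : ℂ),
      planeOp (tX V) a b ε f ∈ ⨆ k : ℕ, (countOp (tX V) (tD V) a b ε).eigenspace (k : ℂ) := by
    refine fun f hf => mem_iSup_eigenspace_of_shift 2 (fun f => ?_) hf
    rw [countOp_apply, countOp_apply, h.plane_plane_d_X hab, map_add, map_smul,
      show (1 + -ε * ε) = 1 - ε ^ 2 by ring, hε, map_add, map_sum,
      Finset.sum_congr rfl fun k hk => by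
        rw [h.plane_d_X (by simp at hk; exact hk.1) (by simp at hk; exact hk.2), h.plane_X_X]]
    push_cast
    norm_num
    abel
  have hz' : ∀ f ∈ ⨆ k : ℕ, (countOp (tX V) (tD V) a b ε).eigenspace (k : ℂ),
      planeOp (tX V) a b (-ε) f ∈ ⨆ k : ℕ, (countOp (tX V) (tD V) a b ε).eigenspace (k : ℂ) := by
    refine fun f hf => mem_iSup_eigenspace_of_shift 0 (fun f => ?_) hf
    rw [countOp_apply, countOp_apply, h.plane_plane_d_X hab,
      show (1 + -ε * -ε) = 1 + ε ^ 2 by ring, hε, add_neg_cancel, zero_smul, add_zero, map_add, map_sum,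
      Finset.sum_congr rfl fun k hk => by
        rw [h.plane_d_X (by simp at hk; exact hk.1) (by simp at hk; exact hk.2), h.plane_X_X]]
    have : ∀ u, planeOp (tX V) a b ε (planeOp (tX V) a b (-ε) u) =
        planeOp (tX V) a b (-ε) (planeOp (tX V) a b ε u) := fun u => by
      rw [planeOp_apply (f := u), map_add, map_smul, ← h.plane_X_X, ← h.plane_X_X, ← planeOp_apply]
    rw [this, Nat.cast_zero, zero_smul, add_zero]
  have hk' : ∀ k, k ≠ a → k ≠ b → ∀ f ∈ ⨆ k : ℕ, (countOp (tX V) (tD V) a b ε).eigenspace (k : ℂ),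
      tX V k f ∈ ⨆ k : ℕ, (countOp (tX V) (tD V) a b ε).eigenspace (k : ℂ) := by
    refine fun k ha hb f hf => mem_iSup_eigenspace_of_shift 1 (fun f => ?_) hf
    rw [countOp_apply, countOp_apply, h.plane_X_d ha hb, ← h.plane_X_X, map_add, map_sum, add_assoc]
    congr 1
    simp only [h.d_X _ k, map_add, h.X_X _ k, Finset.sum_add_distrib]
    simp [apply_ite, Finset.sum_ite_eq', ha, hb]
  refine eq_top_of_tX_mem (fun v => Submodule.mem_iSup_of_mem 0 ?_) fun i f hf => ?_
  · simp [countOp_apply, planeOp_apply]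
  · by_cases ha : i = a
    · rw [ha, show tX V a f = (1 / 2 : ℂ) • (planeOp (tX V) a b ε f + planeOp (tX V) a b (-ε) f) by
        simp only [planeOp_apply]; module]
      exact Submodule.smul_mem _ _ (Submodule.add_mem _ (hz f hf) (hz' f hf))
    by_cases hb : i = b
    · rw [hb, show tX V b f =
          (1 / (2 * ε) : ℂ) • (planeOp (tX V) a b ε f - planeOp (tX V) a b (-ε) f) by
        rw [show planeOp (tX V) a b ε f - planeOp (tX V) a b (-ε) f = (2 * ε) • tX V b f by
          simp only [planeOp_apply]; module, smul_smul, one_div, inv_mul_cancel₀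
          (mul_ne_zero two_ne_zero hε0), one_smul]]
      exact Submodule.smul_mem _ _ (Submodule.sub_mem _ (hz f hf) (hz' f hf))
    exact hk' i ha hb f hf

theorem countOp_add_smul_eq_zero (hg : IsCliffordFamily g) {a b : Fin n} (hab : a ≠ b) {ε : ℂ}
    (hε : ε ^ 2 = -1) {c : ℝ} (hc : 0 < c) {u : MvPolynomial (Fin n) ℂ ⊗[ℂ] V}
    (hu : countOp (tX V) (tD V) a b ε u + (c : ℂ) • u = 0) : u = 0 :=
  eq_zero_of_iSup_eigenspace (iSup_eigenspace_countOp hg hab hε) hc hu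

theorem eulerOp_eq_neg (hg : IsCliffordFamily g) {u : MvPolynomial (Fin n) ℂ ⊗[ℂ] V}
    (hu : eulerOp (tX V) (tD V) u = -u) : u = 0 :=
  eq_zero_of_iSup_eigenspace (iSup_eigenspace_eulerOp hg) one_pos (by simp [hu])

theorem planeOp_tX_injective {a b : Fin n} (hab : a ≠ b) (ε : ℂ) :
    Function.Injective (planeOp (tX V) a b ε) := by
  have : planeOp (tX V) a b ε = (LinearMap.mulLeft ℂ
      (MvPolynomial.X a + MvPolynomial.C ε * MvPolynomial.X b)).rTensor V := by
    refine TensorProduct.ext' fun p v => ?_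
    rw [planeOp_apply, tX_tmul, tX_tmul, LinearMap.rTensor_tmul, LinearMap.mulLeft_apply, add_mul,
      TensorProduct.add_tmul, TensorProduct.smul_tmul', mul_assoc, MvPolynomial.smul_eq_C_mul]
  rw [this]
  refine Module.Flat.rTensor_preserves_injective_linearMap _ 
    fun p q hpq => mul_left_cancel₀ ?_ hpq
  intro h0
  have := congrArg (MvPolynomial.coeff (Finsupp.single a 1)) h0
  rw [MvPolynomial.coeff_add, MvPolynomial.coeff_C_mul, MvPolynomial.coeff_X,
    MvPolynomial.coeff_X, if_pos rfl, if_neg fun he => hab.symm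
      ((Finsupp.single_left_inj one_ne_zero).1 he)] at this
  simp at this

theorem coeff_X_mul_pderiv (i : Fin n) (p : MvPolynomial (Fin n) ℂ) (s : Fin n →₀ ℕ) :
    (MvPolynomial.X i * MvPolynomial.pderiv i p).coeff s = s i * p.coeff s := by
  induction p using MvPolynomial.induction_on' with
  | monomial t c =>
    rw [MvPolynomial.X_mul_pderiv_monomial, MvPolynomial.coeff_smul, MvPolynomial.coeff_monomial]
    split_ifs with h
    · rw [h, nsmul_eq_mul]
    · simp
  | add p q hp hq => rw [map_add, mul_add, MvPolynomial.coeff_add, hp, hq, MvPolynomial.coeff_add,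
      mul_add]

/-- The converse of Euler's identity: the Euler operator multiplies the coefficient at s by the
degree of s, so only degree q can occur. -/
theorem isHomogeneous_iff_sum_X_mul_pderiv {p : MvPolynomial (Fin n) ℂ} {q : ℕ} :
    p.IsHomogeneous q ↔ ∑ i, MvPolynomial.X i * MvPolynomial.pderiv i p = (q : ℂ) • p := by
  refine ⟨fun h => by rw [h.sum_X_mul_pderiv, Nat.cast_smul_eq_nsmul], fun h s hs => ?_⟩
  have h1 := congrArg (MvPolynomial.coeff s) h
  rw [MvPolynomial.coeff_sum, Finset.sum_congr rfl fun i _ => coeff_X_mul_pderiv i p s,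
    ← Finset.sum_mul, MvPolynomial.coeff_smul, smul_eq_mul] at h1
  have h2 := mul_right_cancel₀ hs h1
  rw [Finsupp.weight_apply, Finsupp.sum_fintype _ _ (by simp)]
  simp only [Pi.one_apply, smul_eq_mul, mul_one]
  exact_mod_cast h2

/-- A tensor whose coordinates lie in `K` comes from `K ⊗ V`. -/
theorem mem_range_rTensor_of_basis {P : Type*} [AddCommGroup P] [Module ℂ P] {ι : Type*}
    [DecidableEq ι] (B : Module.Basis ι ℂ V) (K : Submodule ℂ P) (f : P ⊗[ℂ] V)
    (hf : ∀ i, TensorProduct.equivFinsuppOfBasisRight B f i ∈ K) :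
    f ∈ LinearMap.range (K.subtype.rTensor V) := by
  rw [← (TensorProduct.equivFinsuppOfBasisRight B).symm_apply_apply f,
    TensorProduct.equivFinsuppOfBasisRight_symm_apply]
  exact Submodule.sum_mem _ fun i _ => ⟨⟨_, hf i⟩ ⊗ₜ B i, rfl⟩

theorem equivFinsuppOfBasisRight_rTensor {P : Type*} [AddCommGroup P] [Module ℂ P] {ι : Type*}
    [DecidableEq ι] (B : Module.Basis ι ℂ V) (T : Module.End ℂ P) (f : P ⊗[ℂ] V) (i : ι) :
    TensorProduct.equivFinsuppOfBasisRight B (T.rTensor V f) i =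
      T (TensorProduct.equivFinsuppOfBasisRight B f i) := by
  induction f with
  | zero => simp
  | add f₁ f₂ h₁ h₂ => simp only [map_add, Finsupp.add_apply, h₁, h₂]
  | tmul p v => simp

theorem eulerOp_eq_rTensor : (eulerOp (tX V) (tD V) : Module.End ℂ (MvPolynomial (Fin n) ℂ ⊗[ℂ] V)) =
    (∑ i, LinearMap.mulLeft ℂ (MvPolynomial.X i) ∘ₗ
      (MvPolynomial.pderiv i).toLinearMap : Module.End ℂ (MvPolynomial (Fin n) ℂ)).rTensor V := by
  refine TensorProduct.ext' fun p v => ?_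
  simp [eulerOp_apply, TensorProduct.sum_tmul]

theorem lapOp_eq_rTensor : (lapOp (tD V) : Module.End ℂ (MvPolynomial (Fin n) ℂ ⊗[ℂ] V)) =
    (laplacian n).rTensor V := by
  refine TensorProduct.ext' fun p v => ?_
  simp [lapOp_apply, laplacian, TensorProduct.sum_tmul]

theorem mem_range_homogeneousSubmodule {q : ℕ} {f : MvPolynomial (Fin n) ℂ ⊗[ℂ] V}
    (hf : eulerOp (tX V) (tD V) f = (q : ℂ) • f) :
    f ∈ LinearMap.range ((MvPolynomial.homogeneousSubmodule (Fin n) ℂ q).subtype.rTensor V) := by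
  classical
  refine mem_range_rTensor_of_basis (Module.Basis.ofVectorSpace ℂ V) _ f fun i => ?_
  rw [MvPolynomial.mem_homogeneousSubmodule, isHomogeneous_iff_sum_X_mul_pderiv]
  rw [eulerOp_eq_rTensor] at hf
  have := congrArg (fun u => TensorProduct.equivFinsuppOfBasisRight
    (Module.Basis.ofVectorSpace ℂ V) u i) hf
  simpa [equivFinsuppOfBasisRight_rTensor] using this

theorem mem_harmonicTensor {q : ℕ} {f : MvPolynomial (Fin n) ℂ ⊗[ℂ] V} :
    f ∈ harmonicTensor n q V ↔
      eulerOp (tX V) (tD V) f = (q : ℂ) • f ∧ lapOp (tD V) f = 0 := by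
  classical
  constructor
  · rintro ⟨u, rfl⟩
    induction u with
    | zero => simp
    | add u₁ u₂ h₁ h₂ =>
      rw [map_add, map_add, map_add, h₁.1, h₂.1, h₁.2, h₂.2, smul_add, add_zero]
      exact ⟨rfl, rfl⟩
    | tmul p v =>
      obtain ⟨p, hp, hp'⟩ := p
      have h1 := isHomogeneous_iff_sum_X_mul_pderiv.1 hp
      rw [eulerOp_eq_rTensor, lapOp_eq_rTensor, LinearMap.rTensor_tmul, LinearMap.rTensor_tmul,
        LinearMap.rTensor_tmul, Submodule.subtype_apply, LinearMap.mem_ker.1 hp']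
      refine ⟨?_, by simp⟩
      rw [TensorProduct.smul_tmul', ← h1]
      simp
  · rintro ⟨h1, h2⟩
    refine mem_range_rTensor_of_basis (Module.Basis.ofVectorSpace ℂ V) _ f fun i => ⟨?_, ?_⟩
    · change _ ∈ MvPolynomial.homogeneousSubmodule _ _ _
      rw [MvPolynomial.mem_homogeneousSubmodule, isHomogeneous_iff_sum_X_mul_pderiv]
      rw [eulerOp_eq_rTensor] at h1
      have := congrArg (fun u => TensorProduct.equivFinsuppOfBasisRight
        (Module.Basis.ofVectorSpace ℂ V) u i) h1
      simpa [equivFinsuppOfBasisRight_rTensor] using this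
    · rw [lapOp_eq_rTensor] at h2
      have := congrArg (fun u => TensorProduct.equivFinsuppOfBasisRight
        (Module.Basis.ofVectorSpace ℂ V) u i) h2
      simpa [equivFinsuppOfBasisRight_rTensor] using this

instance finiteDimensional_harmonicTensor [FiniteDimensional ℂ V] (q : ℕ) :
    FiniteDimensional ℂ (harmonicTensor n q V) := by
  have : FiniteDimensional ℂ (MvPolynomial.homogeneousSubmodule (Fin n) ℂ q) :=
    Module.Finite.iff_fg.2 (MvPolynomial.homogeneousSubmodule_fg _ _ q)
  have : FiniteDimensional ℂ (harmonic n q) :=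
    Submodule.finiteDimensional_of_le (inf_le_left : harmonic n q ≤ _)
  unfold harmonicTensor
  infer_instance

theorem exists_eq_one_tmul {f : MvPolynomial (Fin n) ℂ ⊗[ℂ] V}
    (hf : eulerOp (tX V) (tD V) f = 0) : ∃ v : V, f = 1 ⊗ₜ v := by
  obtain ⟨u, rfl⟩ := mem_range_homogeneousSubmodule (q := 0) (f := f) (by simpa using hf)
  clear hf
  induction u with
  | zero => exact ⟨0, by simp⟩
  | add u₁ u₂ h₁ h₂ =>
    obtain ⟨v₁, e₁⟩ := h₁
    obtain ⟨v₂, e₂⟩ := h₂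
    exact ⟨v₁ + v₂, by rw [map_add, e₁, e₂, TensorProduct.tmul_add]⟩
  | tmul p v =>
    obtain ⟨p, hp⟩ := p
    rw [MvPolynomial.mem_homogeneousSubmodule, ← MvPolynomial.totalDegree_zero_iff_isHomogeneous,
      MvPolynomial.totalDegree_eq_zero_iff_eq_C] at hp
    refine ⟨p.coeff 0 • v, ?_⟩
    rw [LinearMap.rTensor_tmul, Submodule.subtype_apply, ← TensorProduct.smul_tmul,
      MvPolynomial.smul_eq_C_mul, mul_one, ← hp]

theorem one_tmul_injective {v : V} (hv : (1 : MvPolynomial (Fin n) ℂ) ⊗ₜ[ℂ] v = 0) : v = 0 := by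
  have := congrArg ((TensorProduct.lid ℂ V).toLinearMap ∘ₗ
    (MvPolynomial.aeval (R := ℂ) (fun _ : Fin n => (0 : ℂ))).toLinearMap.rTensor V) hv
  simpa using this

/-- Polynomials that only depend on `X a + ε X b` are the multiples of its powers. -/
theorem exists_eq_planeOp_pow (hg : IsCliffordFamily g) {a b : Fin n} (hab : a ≠ b) {ε : ℂ}
    (hε : ε ^ 2 = -1) {q : ℕ} {f : MvPolynomial (Fin n) ℂ ⊗[ℂ] V}
    (hE : eulerOp (tX V) (tD V) f = (q : ℂ) • f) (h1 : planeOp (tD V) a b ε f = 0)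
    (h2 : ∀ k, k ≠ a → k ≠ b → tD V k f = 0) :
    ∃ v : V, f = (planeOp (tX V) a b ε ^ q) (1 ⊗ₜ v) := by
  have h := hg.weylClifford
  induction q generalizing f with
  | zero => simpa using exists_eq_one_tmul (by simpa using hE)
  | succ q ih =>
    have hE' : eulerOp (tX V) (tD V) (planeOp (tD V) a b (-ε) f) =
        (q : ℂ) • planeOp (tD V) a b (-ε) f := by
      rw [planeOp_apply, map_add, map_smul, h.euler_d, h.euler_d, hE]
      push_cast
      simp only [map_smul]
      module
    have h1' : planeOp (tD V) a b ε (planeOp (tD V) a b (-ε) f) = 0 := by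
      rw [planeOp_apply (f := f), map_add, map_smul, ← h.plane_d_d, ← h.plane_d_d, h1]
      simp
    obtain ⟨v, hv⟩ := ih hE' h1' fun k ha hb => by rw [h.plane_d_d, h2 k ha hb, map_zero]
    -- Only the term z∂̄ of 2E survives on f, so 2(q+1) f = z∂̄f, and ∂̄f is a multiple of z^q by
    -- induction.
    have := eulerOp_eq_plane (X := tX V) (d := tD V) hε hab f
    rw [h1, map_zero, add_zero, Finset.sum_eq_zero (fun k hk => by
      simp only [Finset.mem_compl, Finset.mem_insert, Finset.mem_singleton, not_or] at hk
      rw [h2 k hk.1 hk.2, map_zero]), smul_zero, add_zero, hv, hE] at this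
    refine ⟨(2 * (q + 1 : ℂ))⁻¹ • v, ?_⟩
    have hq : (2 * (q + 1 : ℂ)) ≠ 0 := mul_ne_zero two_ne_zero (Nat.cast_add_one_ne_zero q)
    rw [TensorProduct.tmul_smul, map_smul, pow_succ', Module.End.mul_apply, ← this, smul_smul,
      smul_smul]
    push_cast
    rw [mul_assoc, inv_mul_cancel₀ hq, one_smul]

end Polynomials

/-! ### The Fischer pairing between dual-spinor-valued and spinor-valued polynomials -/

section Pairing

variable {n : ℕ} {V : Type*} [AddCommGroup V] [Module ℂ V]

/-- The Fischer pairing of polynomials, `⟨p, r⟩ = (p(∂) r)(0)`. -/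
noncomputable def fischer (n : ℕ) :
    MvPolynomial (Fin n) ℂ →ₗ[ℂ] Module.Dual ℂ (MvPolynomial (Fin n) ℂ) :=
  (MvPolynomial.basisMonomials (Fin n) ℂ).constr ℂ fun s =>
    ((∏ i, (s i).factorial : ℕ) : ℂ) • MvPolynomial.lcoeff ℂ s

theorem fischer_monomial (s : Fin n →₀ ℕ) (c : ℂ) (p : MvPolynomial (Fin n) ℂ) :
    fischer n (MvPolynomial.monomial s c) p =
      c * (((∏ i, (s i).factorial : ℕ) : ℂ) * p.coeff s) := by
  have : fischer n (MvPolynomial.monomial s 1) p =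
      ((∏ i, (s i).factorial : ℕ) : ℂ) * p.coeff s := by
    rw [← congrFun (MvPolynomial.coe_basisMonomials (Fin n) ℂ) s, fischer,
      Module.Basis.constr_basis]
    simp
  rw [← mul_one c, ← smul_eq_mul, ← MvPolynomial.smul_monomial, map_smul, LinearMap.smul_apply,
    this, smul_eq_mul, smul_eq_mul, mul_one]

theorem prod_factorial_add_single (s : Fin n →₀ ℕ) (i : Fin n) :
    ∏ j, ((s + Finsupp.single i 1 : Fin n →₀ ℕ) j).factorial = (s i + 1) * ∏ j, (s j).factorial := by
  rw [← Finset.mul_prod_erase _ _ (Finset.mem_univ i),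
    ← Finset.mul_prod_erase Finset.univ (fun j => (s j).factorial) (Finset.mem_univ i),
    Finset.prod_congr rfl (g := fun j => (s j).factorial) fun j hj => by
      rw [Finsupp.add_apply, Finsupp.single_eq_of_ne (Finset.ne_of_mem_erase hj), add_zero]]
  simp [Nat.factorial_succ, mul_assoc]

theorem fischer_X_mul (i : Fin n) (p r : MvPolynomial (Fin n) ℂ) :
    fischer n (MvPolynomial.X i * p) r = fischer n p (MvPolynomial.pderiv i r) := by
  induction p using MvPolynomial.induction_on' with
  | monomial s c =>
    rw [MvPolynomial.X, MvPolynomial.monomial_mul, one_mul, fischer_monomial, fischer_monomial,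
      MvPolynomial.coeff_pderiv, add_comm, prod_factorial_add_single]
    push_cast
    ring
  | add p q hp hq => simp only [mul_add, map_add, LinearMap.add_apply, hp, hq]

theorem fischer_comm (p r : MvPolynomial (Fin n) ℂ) : fischer n p r = fischer n r p := by
  induction p using MvPolynomial.induction_on' with
  | monomial s c =>
    induction r using MvPolynomial.induction_on' with
    | monomial t e =>
      rw [fischer_monomial, fischer_monomial, MvPolynomial.coeff_monomial,
        MvPolynomial.coeff_monomial]
      by_cases hst : s = t
      · rw [hst, if_pos rfl, if_pos rfl]; ring
      · rw [if_neg hst, if_neg (Ne.symm hst)]; ring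
    | add p q hp hq => simp only [map_add, LinearMap.add_apply, hp, hq]
  | add p q hp hq => simp only [map_add, LinearMap.add_apply, hp, hq]

theorem fischer_pderiv (i : Fin n) (p r : MvPolynomial (Fin n) ℂ) :
    fischer n (MvPolynomial.pderiv i p) r = fischer n p (MvPolynomial.X i * r) := by
  rw [fischer_comm, ← fischer_X_mul, fischer_comm]

/-- The Fischer pairing of polynomials with values in `V*` and in `V`. -/
noncomputable def pairing (n : ℕ) (V : Type*) [AddCommGroup V] [Module ℂ V] :
    MvPolynomial (Fin n) ℂ ⊗[ℂ] Module.Dual ℂ V →ₗ[ℂ]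
      Module.Dual ℂ (MvPolynomial (Fin n) ℂ ⊗[ℂ] V) :=
  TensorProduct.dualDistrib ℂ _ _ ∘ₗ (fischer n).rTensor (Module.Dual ℂ V)

@[simp] theorem pairing_tmul (p r : MvPolynomial (Fin n) ℂ) (φ : Module.Dual ℂ V) (v : V) :
    pairing n V (p ⊗ₜ φ) (r ⊗ₜ v) = fischer n p r * φ v := rfl

/-- The transposed Clifford family on the dual space. -/
def dualFamily (g : Fin n → Module.End ℂ V) (i : Fin n) : Module.End ℂ (Module.Dual ℂ V) :=
  (g i).dualMap

/-- Transposition reverses products, and the Clifford relations are symmetric in i and j. -/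
theorem IsCliffordFamily.dual {g : Fin n → Module.End ℂ V} (hg : IsCliffordFamily g) :
    IsCliffordFamily (dualFamily g) := by
  intro i j φ
  ext v
  change φ (g j (g i v)) = _
  rw [hg j i v]
  simp only [eq_comm (a := i)]
  split_ifs <;> simp [dualFamily]

theorem pairing_adjoint {A : Module.End ℂ (MvPolynomial (Fin n) ℂ ⊗[ℂ] Module.Dual ℂ V)}
    {B : Module.End ℂ (MvPolynomial (Fin n) ℂ ⊗[ℂ] V)}
    (h : ∀ p φ r v, pairing n V (A (p ⊗ₜ φ)) (r ⊗ₜ v) = pairing n V (p ⊗ₜ φ) (B (r ⊗ₜ v)))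
    (ψ : MvPolynomial (Fin n) ℂ ⊗[ℂ] Module.Dual ℂ V) (f : MvPolynomial (Fin n) ℂ ⊗[ℂ] V) :
    pairing n V (A ψ) f = pairing n V ψ (B f) := by
  induction ψ with
  | zero => simp
  | add ψ₁ ψ₂ h₁ h₂ => simp only [map_add, LinearMap.add_apply, h₁, h₂]
  | tmul p φ =>
    induction f with
    | zero => simp
    | add f₁ f₂ h₁ h₂ => simp only [map_add, h₁, h₂]
    | tmul r v => exact h p φ r v

variable (ψ : MvPolynomial (Fin n) ℂ ⊗[ℂ] Module.Dual ℂ V) (f : MvPolynomial (Fin n) ℂ ⊗[ℂ] V)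

theorem pairing_tX (i : Fin n) : pairing n V (tX _ i ψ) f = pairing n V ψ (tD _ i f) :=
  pairing_adjoint (fun p φ r v => by simp [fischer_X_mul]) ψ f

theorem pairing_tD (i : Fin n) : pairing n V (tD _ i ψ) f = pairing n V ψ (tX _ i f) :=
  pairing_adjoint (fun p φ r v => by simp [fischer_pderiv]) ψ f

theorem pairing_tG (g : Fin n → Module.End ℂ V) (i : Fin n) :
    pairing n V (tG (dualFamily g) i ψ) f = pairing n V ψ (tG g i f) :=
  pairing_adjoint (fun p φ r v => by simp [dualFamily]) ψ f

theorem pairing_rotOp (g : Fin n → Module.End ℂ V) (k l : Fin n) :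
    pairing n V (rotOp (tX _) (tD _) (tG (dualFamily g)) k l ψ) f =
      -pairing n V ψ (rotOp (tX _) (tD _) (tG g) k l f) := by
  simp only [rotOp_apply, map_add, map_sub, map_smul, LinearMap.add_apply, LinearMap.sub_apply,
    LinearMap.smul_apply, pairing_tX, pairing_tD, pairing_tG]
  module

/-- As x is the transpose of D, multiples of x pair to zero with monogenics; functionals on M_q can
therefore be represented by monogenics. -/
theorem pairing_vecOp (g : Fin n → Module.End ℂ V) :
    pairing n V (vecOp (tX _) (tG (dualFamily g)) ψ) f =
      pairing n V ψ (diracOp (tD _) (tG g) f) := by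
  simp only [vecOp_apply, diracOp_apply, map_sum, LinearMap.sum_apply, pairing_tX, pairing_tG]

theorem pairing_planeOp_pow (a b : Fin n) (ε : ℂ) (q : ℕ) :
    pairing n V ((planeOp (tX _) a b ε ^ q) ψ) f =
      pairing n V ψ ((planeOp (tD _) a b ε ^ q) f) := by
  induction q generalizing f with
  | zero => rfl
  | succ q ih =>
    rw [pow_succ', Module.End.mul_apply, pow_succ, Module.End.mul_apply, ← ih]
    simp only [planeOp_apply, map_add, map_smul, LinearMap.add_apply, LinearMap.smul_apply,
      pairing_tX]

/-- Every functional on the `V`-valued polynomials of degree `q` is given by the pairing. -/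
theorem exists_pairing_eq (ℓ : Module.Dual ℂ (MvPolynomial (Fin n) ℂ ⊗[ℂ] V)) (q : ℕ) :
    ∃ ψ : MvPolynomial (Fin n) ℂ ⊗[ℂ] Module.Dual ℂ V,
      eulerOp (tX _) (tD _) ψ = (q : ℂ) • ψ ∧
      ∀ f, eulerOp (tX V) (tD V) f = (q : ℂ) • f → pairing n V ψ f = ℓ f := by
  let S := Finset.finsuppAntidiag (Finset.univ : Finset (Fin n)) q
  have hfac : ∀ s : Fin n →₀ ℕ, ((∏ i, (s i).factorial : ℕ) : ℂ) ≠ 0 := fun s =>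
    Nat.cast_ne_zero.2 (Finset.prod_ne_zero_iff.2 fun i _ => Nat.factorial_ne_zero _)
  -- The witness is the sum of x^s/s! ⊗ ℓ(x^s ⊗ ·) over the exponents s of degree q, because x^s/s!
  -- pairs with r to give the coefficient of x^s in r.
  refine ⟨∑ s ∈ S, MvPolynomial.monomial s ((∏ i, (s i).factorial : ℕ) : ℂ)⁻¹ ⊗ₜ
    (ℓ ∘ₗ TensorProduct.mk ℂ _ V (MvPolynomial.monomial s 1)), ?_, fun f hf => ?_⟩
  · rw [map_sum, Finset.smul_sum]
    refine Finset.sum_congr rfl fun s hs => ?_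
    rw [eulerOp_apply, TensorProduct.smul_tmul', ← isHomogeneous_iff_sum_X_mul_pderiv.1,
      TensorProduct.sum_tmul]
    · rfl
    · refine MvPolynomial.isHomogeneous_monomial _ ?_
      rw [Finset.mem_finsuppAntidiag] at hs
      rw [Finsupp.degree_eq_sum, hs.1]
  · obtain ⟨u, rfl⟩ := mem_range_homogeneousSubmodule hf
    clear hf
    induction u with
    | zero => simp
    | add u₁ u₂ h₁ h₂ => simp only [map_add, h₁, h₂]
    | tmul p v =>
      obtain ⟨p, hp⟩ := p
      rw [MvPolynomial.mem_homogeneousSubmodule] at hp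
      have hsub : p.support ⊆ S := by
        intro s hs
        rw [Finset.mem_finsuppAntidiag]
        refine ⟨?_, Finset.subset_univ _⟩
        have := hp (MvPolynomial.mem_support_iff.1 hs)
        rw [Finsupp.weight_apply, Finsupp.sum_fintype _ _ (by simp)] at this
        simpa using this
      have hpS : p = ∑ s ∈ S, p.coeff s • MvPolynomial.monomial s (1 : ℂ) := by
        conv_lhs => rw [p.as_sum]
        rw [Finset.sum_subset hsub]
        · simp [MvPolynomial.smul_monomial]
        · intro s _ hs
          rw [MvPolynomial.notMem_support_iff.1 hs, map_zero]
      rw [LinearMap.rTensor_tmul, Submodule.subtype_apply, map_sum, LinearMap.sum_apply]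
      change _ = ℓ (p ⊗ₜ v)
      conv_rhs => rw [hpS, TensorProduct.sum_tmul, map_sum]
      refine Finset.sum_congr rfl fun s _ => ?_
      rw [pairing_tmul, fischer_monomial, inv_mul_cancel_left₀ (hfac s), ← TensorProduct.smul_tmul',
        map_smul]
      rfl

end Pairing

/-! ### Irreducibility of spinor spaces under even products; vacuum vectors -/

section Spinors

variable {V : Type*} [AddCommGroup V] [Module ℂ V]

/-- No proper nonzero subspace is invariant under the operators `gᵢ`. -/
def IsIrreducibleFamily {ι : Type*} (g : ι → Module.End ℂ V) : Prop :=
  ∀ W : Submodule ℂ V, (∀ i, ∀ w ∈ W, g i w ∈ W) → W = ⊥ ∨ W = ⊤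

/-- The product of the first `2k` operators of a Clifford family. -/
theorem IsCliffordFamily.exists_prod {m : ℕ} {g : Fin (2 * m + 1) → Module.End ℂ V}
    (hg : IsCliffordFamily g) (k : ℕ) (hk : k ≤ m) : ∃ P : Module.End ℂ V, Function.Injective P ∧
      (∀ i v, P (g i v) = (if (i : ℕ) < 2 * k then -1 else 1 : ℂ) • g i (P v)) ∧
      ∀ W : Submodule ℂ V, (∀ j : Fin m, ∀ w ∈ W, g (idxA j) (g (idxB j) w) ∈ W) →
        ∀ w ∈ W, P w ∈ W := by
  induction k with
  | zero => exact ⟨1, Function.injective_id, fun i v => by simp, fun W _ w hw => hw⟩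
  | succ k ih =>
    obtain ⟨P, hP, hc, hW⟩ := ih (by omega)
    let j : Fin m := ⟨k, by omega⟩
    have hAB : idxA j ≠ idxB j := by simp [idxA, idxB, Fin.ext_iff]
    have hinj : ∀ i, Function.Injective (g i) := fun i u v huv => by
      rw [← neg_neg u, ← neg_neg v, ← hg.self i u, huv, hg.self]
    refine ⟨P * g (idxA j) * g (idxB j), (hP.comp (hinj _)).comp (hinj _), fun i v => ?_,
      fun W h w hw => hW W h _ (h j w hw)⟩
    simp only [Module.End.mul_apply]
    -- P is a product of an even number of generators, none of them among the two new ones, so it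
    -- commutes with both.
    have hcA : ∀ u, P (g (idxA j) u) = g (idxA j) (P u) := fun u => by
      rw [hc, if_neg (by simp [idxA, j]), one_smul]
    have hcB : ∀ u, P (g (idxB j) u) = g (idxB j) (P u) := fun u => by
      rw [hc, if_neg (by simp only [idxB, j]; omega), one_smul]
    by_cases hA : i = idxA j
    · rw [hA, hg.anticomm hAB.symm, if_pos (by simp only [idxA, j]; omega)]
      simp only [map_neg, hcA, hcB, neg_one_smul]
    by_cases hB : i = idxB j
    · rw [hB, if_pos (by simp only [idxB, j]; omega)]
      simp only [hg.self, map_neg, hcA, hcB, hg.anticomm hAB.symm, neg_one_smul, neg_neg]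
    have hiff : (i : ℕ) < 2 * (k + 1) ↔ (i : ℕ) < 2 * k := by
      have hA' : (i : ℕ) ≠ 2 * k := fun h => hA (Fin.ext h)
      have hB' : (i : ℕ) ≠ 2 * k + 1 := fun h => hB (Fin.ext h)
      omega
    rw [hg.anticomm (Ne.symm hB), map_neg, hg.anticomm (Ne.symm hA), neg_neg, hc]
    simp only [hiff]

/-- In odd dimension, the last operator of an irreducible Clifford family is a multiple of the
product of the others. -/
theorem IsCliffordFamily.last_mem [FiniteDimensional ℂ V] [Nontrivial V] {m : ℕ}
    {g : Fin (2 * m + 1) → Module.End ℂ V} (hg : IsCliffordFamily g) (hi : IsIrreducibleFamily g)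
    {W : Submodule ℂ V} (hW : ∀ j : Fin m, ∀ w ∈ W, g (idxA j) (g (idxB j) w) ∈ W) {w : V}
    (hw : w ∈ W) : g (Fin.last (2 * m)) w ∈ W := by
  obtain ⟨P, hP, hc, hPW⟩ := hg.exists_prod m le_rfl
  let z := Fin.last (2 * m)
  -- The volume element P g_z is central: for i ≠ z, passing g i through g z and through P gives two
  -- signs that cancel. An eigenspace of it is then everything.
  have hcomm : ∀ i v, P (g z (g i v)) = g i (P (g z v)) := by
    intro i v
    by_cases hiz : i = z
    · rw [hiz, hc, if_neg (by simp [z]), one_smul]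
    · have hlt : (i : ℕ) < 2 * m := by
        have := i.2
        have h2 : (i : ℕ) ≠ 2 * m := fun h => hiz (Fin.ext h)
        omega
      rw [hg.anticomm (Ne.symm hiz), map_neg, hc, if_pos hlt, neg_one_smul, neg_neg]
  obtain ⟨c, hcv⟩ := Module.End.exists_eigenvalue (P * g z)
  have htop : (P * g z).eigenspace c = ⊤ := by
    refine (hi _ fun i v hv => ?_).resolve_left hcv
    rw [Module.End.mem_eigenspace_iff, Module.End.mul_apply] at hv ⊢
    rw [hcomm, hv, map_smul]
  have hz : ∀ v, P (g z v) = c • v := fun v =>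
    Module.End.mem_eigenspace_iff.1 (htop ▸ Submodule.mem_top : v ∈ (P * g z).eigenspace c)
  have hz' : ∀ v, c • g z v = -P v := fun v => by rw [← hz, hg.self, map_neg]
  have hc0 : c ≠ 0 := by
    rintro rfl
    obtain ⟨v, hv⟩ := exists_ne (0 : V)
    refine hv (hP ?_)
    have := hz' v
    rw [zero_smul, eq_comm, neg_eq_zero] at this
    rw [this, map_zero]
  have : g z w = -(c⁻¹ • P w) := by
    rw [← smul_neg, ← hz', smul_smul, inv_mul_cancel₀ hc0, one_smul]
  change g z w ∈ W
  rw [this]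
  exact W.neg_mem (W.smul_mem _ (hPW W hW w hw))

/-- A spinor space is irreducible under the even part of the Clifford algebra. -/
theorem IsCliffordFamily.eq_bot_or_eq_top [FiniteDimensional ℂ V] [Nontrivial V] {m : ℕ}
    {g : Fin (2 * m + 1) → Module.End ℂ V} (hg : IsCliffordFamily g) (hi : IsIrreducibleFamily g)
    {W : Submodule ℂ V} (hW : ∀ k l, k ≠ l → ∀ w ∈ W, g k (g l w) ∈ W) : W = ⊥ ∨ W = ⊤ := by
  have hlast : ∀ w ∈ W, g (Fin.last (2 * m)) w ∈ W := fun w hw =>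
    hg.last_mem hi (fun j => hW _ _ (by simp [idxA, idxB, Fin.ext_iff])) hw
  refine hi W fun i w hw => ?_
  by_cases h : i = Fin.last (2 * m)
  · rw [h]; exact hlast w hw
  · rw [← neg_neg w, ← hg.self (Fin.last (2 * m)) w, map_neg]
    exact W.neg_mem (hW _ _ h _ (hlast w hw))

/-- The kernel of `g a + ε g b` on a spinor space is irreducible under the products `gₖ gₗ` with
`k, l ∉ {a, b}`. -/
theorem IsCliffordFamily.mem_of_planeOp_eq_zero [FiniteDimensional ℂ V] [Nontrivial V] {m : ℕ}
    {g : Fin (2 * m + 1) → Module.End ℂ V} (hg : IsCliffordFamily g) (hi : IsIrreducibleFamily g)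
    (j₀ : Fin m) {ε : ℂ} (hε : ε ^ 2 = -1) {T : Submodule ℂ V} (hT0 : T ≠ ⊥)
    (hT : ∀ t ∈ T, planeOp g (idxA j₀) (idxB j₀) ε t = 0)
    (hinv : ∀ k l, k ≠ l → k ≠ idxA j₀ → k ≠ idxB j₀ → l ≠ idxA j₀ → l ≠ idxB j₀ →
      ∀ t ∈ T, g k (g l t) ∈ T) {v : V} (hv : planeOp g (idxA j₀) (idxB j₀) ε v = 0) : v ∈ T := by
  have hab : idxA j₀ ≠ idxB j₀ := by simp [idxA, idxB, Fin.ext_iff]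
  have hε0 : ε ≠ 0 := by rintro rfl; norm_num at hε
  have hlast : ∀ t ∈ T, g (Fin.last (2 * m)) t ∈ T := by
    refine fun t ht => hg.last_mem hi (fun j t ht => ?_) ht
    by_cases hj : j = j₀
    -- For the distinguished pair, g_a t = -ε g_b t turns g_a g_b into the scalar -ε on T.
    · have h1 := hT t ht
      rw [planeOp_apply] at h1
      rw [hj, hg.anticomm hab, eq_neg_of_add_eq_zero_left h1, map_neg, neg_neg, map_smul, hg.self]
      exact T.smul_mem _ (T.neg_mem ht)
    · have : (j : ℕ) ≠ j₀ := fun h => hj (Fin.ext h)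
      refine hinv _ _ ?_ ?_ ?_ ?_ ?_ t ht <;> simp only [idxA, idxB, ne_eq, Fin.mk.injEq] <;> omega
  have hl : Fin.last (2 * m) ≠ idxA j₀ ∧ Fin.last (2 * m) ≠ idxB j₀ := by
    have := j₀.2
    constructor <;> simp only [idxA, idxB, ne_eq, Fin.ext_iff, Fin.val_last] <;> omega
  have hk : ∀ k, k ≠ idxA j₀ → k ≠ idxB j₀ → ∀ t ∈ T, g k t ∈ T := by
    intro k ha hb t ht
    by_cases h : k = Fin.last (2 * m)
    · rw [h]; exact hlast t ht
    · rw [← neg_neg t, ← hg.self (Fin.last (2 * m)) t, map_neg]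
      exact T.neg_mem (hinv _ _ h ha hb hl.1 hl.2 _ (hlast t ht))
  let Γ := planeOp g (idxA j₀) (idxB j₀) ε
  let Γ' := planeOp g (idxA j₀) (idxB j₀) (-ε)
  have hΓΓ' : ∀ t ∈ T, Γ (Γ' t) = (-4 : ℂ) • t := fun t ht => by
    have := hg.plane_plane (ε := ε) hab (-ε) t
    rw [hT t ht, map_zero, neg_zero, zero_sub, show 2 * (1 + ε * -ε) = 2 * (1 - ε ^ 2) by ring,
      hε] at this
    change planeOp g _ _ ε (planeOp g _ _ (-ε) t) = _
    rw [this]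
    module
  -- T + Γ'T is stable under the whole family: Γ kills T and maps Γ'T back to T, Γ'² = 0, and the
  -- remaining g_k preserve T and anticommute with Γ'. Hence it is all of V.
  have hU : ∀ i, ∀ u ∈ T ⊔ T.map Γ', g i u ∈ T ⊔ T.map Γ' := by
    have h1 : ∀ u ∈ T ⊔ T.map Γ', Γ u ∈ T ⊔ T.map Γ' := by
      intro u hu
      obtain ⟨t, ht, _, ⟨t', ht', rfl⟩, rfl⟩ := Submodule.mem_sup.1 hu
      rw [map_add, hΓΓ' t' ht', show Γ t = 0 from hT t ht, zero_add]
      exact Submodule.mem_sup_left (T.smul_mem _ ht')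
    have h2 : ∀ u ∈ T ⊔ T.map Γ', Γ' u ∈ T ⊔ T.map Γ' := by
      intro u hu
      obtain ⟨t, ht, _, ⟨t', ht', rfl⟩, rfl⟩ := Submodule.mem_sup.1 hu
      rw [map_add, show Γ' (Γ' t') = 0 from hg.plane_self (by rw [neg_sq, hε]) hab t', add_zero]
      exact Submodule.mem_sup_right ⟨t, ht, rfl⟩
    intro i u hu
    by_cases ha : i = idxA j₀
    · rw [ha, show g (idxA j₀) u = (1 / 2 : ℂ) • (Γ u + Γ' u) by
        simp only [Γ, Γ', planeOp_apply]; module]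
      exact Submodule.smul_mem _ _ (Submodule.add_mem _ (h1 u hu) (h2 u hu))
    by_cases hb : i = idxB j₀
    · rw [← one_smul ℂ (g i u), ← inv_mul_cancel₀ (mul_ne_zero two_ne_zero hε0), mul_smul,
        show (2 * ε) • g i u = Γ u - Γ' u by
          simp only [Γ, Γ', planeOp_apply, hb]; module]
      exact Submodule.smul_mem _ _ (Submodule.sub_mem _ (h1 u hu) (h2 u hu))
    obtain ⟨t, ht, _, ⟨t', ht', rfl⟩, rfl⟩ := Submodule.mem_sup.1 hu
    rw [map_add]
    refine Submodule.add_mem _ (Submodule.mem_sup_left (hk i ha hb t ht)) ?_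
    rw [show g i (Γ' t') = -Γ' (g i t') by rw [hg.plane_anticomm ha hb, neg_neg]]
    exact Submodule.neg_mem _ (Submodule.mem_sup_right ⟨_, hk i ha hb t' ht', rfl⟩)
  have htop : T ⊔ T.map Γ' = ⊤ := (hi _ hU).resolve_left fun h =>
    hT0 (le_bot_iff.1 (h ▸ le_sup_left))
  obtain ⟨t, ht, _, ⟨t', ht', rfl⟩, rfl⟩ :=
    Submodule.mem_sup.1 (htop ▸ Submodule.mem_top : v ∈ T ⊔ T.map Γ')
  -- Γ(t + Γ't') = -4t', so t' = 0 and v = t.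
  have h0 : Γ (t + Γ' t') = 0 := hv
  rw [map_add, hΓΓ' t' ht', show Γ t = 0 from hT t ht, zero_add] at h0
  rw [(smul_eq_zero.1 h0).resolve_left (by norm_num), map_zero, add_zero]
  exact ht

/-- A spinor space contains a vacuum vector. -/
theorem IsCliffordFamily.exists_vacuum [Nontrivial V] {m : ℕ}
    {g : Fin (2 * m + 1) → Module.End ℂ V} (hg : IsCliffordFamily g) :
    ∃ v : V, v ≠ 0 ∧ ∀ j, planeOp g (idxA j) (idxB j) (-Complex.I) v = 0 := by
  have hab : ∀ j : Fin m, idxA j ≠ idxB j := fun j => by simp [idxA, idxB, Fin.ext_iff]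
  suffices ∀ k ≤ m, ∃ v : V, v ≠ 0 ∧
      ∀ j : Fin m, (j : ℕ) < k → planeOp g (idxA j) (idxB j) (-Complex.I) v = 0 by
    obtain ⟨v, hv, h⟩ := this m le_rfl
    exact ⟨v, hv, fun j => h j j.2⟩
  intro k hk
  induction k with
  | zero =>
    obtain ⟨v, hv⟩ := exists_ne (0 : V)
    exact ⟨v, hv, fun j hj => absurd hj (Nat.not_lt_zero _)⟩
  | succ k ih =>
    obtain ⟨v, hv, h⟩ := ih (by omega)
    let i : Fin m := ⟨k, by omega⟩
    -- If v is not already killed by the k-th operator, replace v by its image: the operator squares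
    -- to zero and anticommutes with the generators in the earlier operators.
    by_cases hi : planeOp g (idxA i) (idxB i) (-Complex.I) v = 0
    · refine ⟨v, hv, fun j hj => ?_⟩
      rcases Nat.lt_succ_iff_lt_or_eq.1 hj with hj | hj
      · exact h j hj
      · rw [show j = i from Fin.ext hj]; exact hi
    · refine ⟨_, hi, fun j hj => ?_⟩
      rcases Nat.lt_succ_iff_lt_or_eq.1 hj with hj | hj
      · have hne : (j : ℕ) ≠ k := hj.ne
        rw [planeOp_apply (a := idxA i), map_add, map_smul, hg.plane_anticomm, hg.plane_anticomm,
          h j hj]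
        · simp
        all_goals simp only [idxA, idxB, ne_eq, Fin.mk.injEq, i]; omega
      · rw [show j = i from Fin.ext hj]
        exact hg.plane_self (by rw [neg_sq, Complex.I_sq]) (hab i) v

end Spinors

/-! ### Irreducibility of the monogenic polynomials -/

section Monogenic

variable {n : ℕ} {V : Type*} [AddCommGroup V] [Module ℂ V]

/-- The monogenic `V`-valued polynomials of degree `q`. -/
noncomputable def monogenic (g : Fin n → Module.End ℂ V) (q : ℕ) :
    Submodule ℂ (MvPolynomial (Fin n) ℂ ⊗[ℂ] V) :=
  (eulerOp (tX V) (tD V)).eigenspace (q : ℂ) ⊓ LinearMap.ker (diracOp (tD V) (tG g))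

variable {g : Fin n → Module.End ℂ V}

theorem mem_monogenic {q : ℕ} {f : MvPolynomial (Fin n) ℂ ⊗[ℂ] V} : f ∈ monogenic g q ↔
    eulerOp (tX V) (tD V) f = (q : ℂ) • f ∧ diracOp (tD V) (tG g) f = 0 := by
  rw [monogenic, Submodule.mem_inf, Module.End.mem_eigenspace_iff, LinearMap.mem_ker]

theorem monogenic_eq (hg : IsCliffordFamily g) (q : ℕ) : monogenic g q =
    harmonicTensor n q V ⊓ LinearMap.ker (diracOp (tD V) (tG g)) := by
  ext f
  rw [mem_monogenic, Submodule.mem_inf, mem_harmonicTensor, LinearMap.mem_ker]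
  refine ⟨fun h => ⟨⟨h.1, ?_⟩, h.2⟩, fun h => ⟨h.1.1, h.2⟩⟩
  rw [← neg_neg (lapOp _ f), ← hg.weylClifford.dirac_dirac, h.2, map_zero, neg_zero]

/-- A subspace invariant under the infinitesimal rotations. -/
def IsRotInvariant (g : Fin n → Module.End ℂ V)
    (W : Submodule ℂ (MvPolynomial (Fin n) ℂ ⊗[ℂ] V)) : Prop :=
  ∀ k l, ∀ w ∈ W, rotOp (tX V) (tD V) (tG g) k l w ∈ W

/-- A nonzero invariant space of monogenic polynomials contains an element `z^q v`, where
`z = X a + ε X b`. -/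
theorem exists_planeOp_pow_mem [FiniteDimensional ℂ V] (hn : 3 ≤ n) (hg : IsCliffordFamily g)
    {q : ℕ} {W : Submodule ℂ (MvPolynomial (Fin n) ℂ ⊗[ℂ] V)} (hW0 : W ≠ ⊥)
    (hW : W ≤ monogenic g q) (hinv : IsRotInvariant g W) {a b : Fin n} (hab : a ≠ b) {ε : ℂ}
    (hε : ε ^ 2 = -1) : ∃ v : V, v ≠ 0 ∧ planeOp g a b ε v = 0 ∧
      (planeOp (tX V) a b ε ^ q) (1 ⊗ₜ v) ∈ W := by
  have h := hg.weylClifford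
  have : FiniteDimensional ℂ W := by
    refine Submodule.finiteDimensional_of_le (hW.trans ?_ : W ≤ harmonicTensor n q V)
    rw [monogenic_eq hg]
    exact inf_le_left
  have hε0 : ε ≠ 0 := by rintro rfl; norm_num at hε
  -- The root vectors [e_a + ε e_b, e_k] shift the eigenvalues of the rotation in the plane of a and
  -- b by -4ε.
  obtain ⟨f, hfW, hf0, hf⟩ := exists_ne_zero_forall_eq_zero (F := MvPolynomial (Fin n) ℂ ⊗[ℂ] V)
    (ι := {k : Fin n // k ≠ a ∧ k ≠ b}) hW0
    (L := rotOp (tX V) (tD V) (tG g) a b) (c := -4 * ε)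
    (E := fun k => rotOp (tX V) (tD V) (tG g) a k + ε • rotOp (tX V) (tD V) (tG g) b k)
    (mul_ne_zero (by norm_num) hε0) (hinv a b)
    (fun k w hw => W.add_mem (hinv a k w hw) (W.smul_mem _ (hinv b k w hw)))
    (fun k f => h.rot_rot_plane hε hab k.2.1 k.2.2 f)
  have hfm := mem_monogenic.1 (hW hfW)
  obtain ⟨h1, h2, h3⟩ := h.eq_zero_of_rot_plane hab hε (planeOp_tX_injective hab ε)
    (fun u hu => countOp_add_smul_eq_zero hg hab hε (c := ((n - 2 : ℕ) : ℝ))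
      (by exact_mod_cast (by omega : 0 < n - 2)) (by simpa using hu)) hfm.2
    (fun k ha hb => hf ⟨k, ha, hb⟩)
  obtain ⟨v, rfl⟩ := exists_eq_planeOp_pow hg hab hε hfm.1 h1 h3
  refine ⟨v, ?_, ?_, hfW⟩
  · rintro rfl
    exact hf0 (by simp)
  · have hcomm : ∀ (j : ℕ) (u : MvPolynomial (Fin n) ℂ ⊗[ℂ] V),
        planeOp (tG g) a b ε ((planeOp (tX V) a b ε ^ j) u) =
          (planeOp (tX V) a b ε ^ j) (planeOp (tG g) a b ε u) := by
      intro j u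
      induction j with
      | zero => rfl
      | succ j ih =>
        rw [pow_succ', Module.End.mul_apply, Module.End.mul_apply, h.plane_plane_G_X, ih]
    rw [hcomm] at h2
    have hinj : Function.Injective (planeOp (tX V) a b ε ^ q) := by
      rw [Module.End.coe_pow]
      exact (planeOp_tX_injective hab ε).iterate q
    have := hinj (h2.trans (map_zero _).symm)
    rw [planeOp_apply, tG_tmul, tG_tmul, ← TensorProduct.tmul_smul, ← TensorProduct.tmul_add] at this
    rw [planeOp_apply]
    exact one_tmul_injective this

theorem planeOp_pow_succ_commutator {F : Type*} [AddCommGroup F] [Module ℂ F]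
    {Z T : Module.End ℂ F} {c : ℂ} (h : ∀ f, T (Z f) = Z (T f) + c • f) (q : ℕ) (f : F) :
    T ((Z ^ (q + 1)) f) = (Z ^ (q + 1)) (T f) + ((q + 1) * c) • (Z ^ q) f := by
  induction q with
  | zero => simp [h]
  | succ q ih =>
    rw [pow_succ', Module.End.mul_apply, h, ih, map_add, map_smul, ← Module.End.mul_apply Z,
      ← Module.End.mul_apply Z, ← pow_succ', ← pow_succ']
    push_cast
    module

/-- The pairing is bilinear, so z̄^q acts as the q-th power of d a - ε d b, whose commutator with z
is 1 - ε² = 2. -/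
theorem pairing_planeOp_pow_planeOp_pow {a b : Fin n} (hg : IsCliffordFamily g) (hab : a ≠ b)
    {ε : ℂ} (hε : ε ^ 2 = -1) (q : ℕ) (φ : Module.Dual ℂ V) (v : V) :
    pairing n V ((planeOp (tX _) a b (-ε) ^ q) (1 ⊗ₜ φ)) ((planeOp (tX V) a b ε ^ q) (1 ⊗ₜ v)) =
      (q.factorial * 2 ^ q : ℂ) * φ v := by
  rw [pairing_planeOp_pow]
  have h := hg.weylClifford
  have key : ∀ j : ℕ, (planeOp (tD V) a b (-ε) ^ j) ((planeOp (tX V) a b ε ^ j) (1 ⊗ₜ v)) =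
      (j.factorial * 2 ^ j : ℂ) • ((1 : MvPolynomial (Fin n) ℂ) ⊗ₜ[ℂ] v) := by
    intro j
    induction j with
    | zero => simp
    | succ j ih =>
      have hd : planeOp (tD V) a b (-ε) ((1 : MvPolynomial (Fin n) ℂ) ⊗ₜ[ℂ] v) = 0 := by
        simp [planeOp_apply]
      rw [pow_succ (planeOp (tD V) a b (-ε)), Module.End.mul_apply,
        planeOp_pow_succ_commutator (c := 2) (fun f => by
          rw [h.plane_plane_d_X hab, show 1 + -ε * ε = 1 - ε ^ 2 by ring, hε]; norm_num),
        hd, map_zero, zero_add, map_smul, ih, smul_smul, Nat.factorial_succ]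
      push_cast
      congr 1
      ring
  rw [key, map_smul, pairing_tmul, ← MvPolynomial.C_1, MvPolynomial.C_apply, fischer_monomial]
  simp

/-- The monogenic polynomials of degree `q` on an odd-dimensional space with values in spinors are
irreducible under infinitesimal rotations. -/
theorem eq_monogenic_of_isRotInvariant [FiniteDimensional ℂ V] [Nontrivial V] {m : ℕ} (hm : 1 ≤ m)
    {g : Fin (2 * m + 1) → Module.End ℂ V} (hg : IsCliffordFamily g) (hi : IsIrreducibleFamily g)
    {q : ℕ} {W : Submodule ℂ (MvPolynomial (Fin (2 * m + 1)) ℂ ⊗[ℂ] V)} (hW0 : W ≠ ⊥)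
    (hW : W ≤ monogenic g q) (hinv : IsRotInvariant g W) : W = monogenic g q := by
  have h := hg.weylClifford
  have hd := hg.dual.weylClifford
  let j₀ : Fin m := ⟨0, hm⟩
  have hab : (idxA j₀) ≠ idxB j₀ := by simp [idxA, idxB, Fin.ext_iff]
  set a := idxA j₀
  set b := idxB j₀
  have hε : (-Complex.I) ^ 2 = -1 := by rw [neg_sq, Complex.I_sq]
  obtain ⟨v₁, hv₁, hv₁', hv₁W⟩ := exists_planeOp_pow_mem (by omega) hg hW0 hW hinv hab hε
  -- The v in ker Γ with z^q v ∈ W form a nonzero space T. It is stable under g k g l for k, l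
  -- outside the plane, since the rotation of k and l commutes with z and acts on constants as 2 g k
  -- g l. So T is all of ker Γ.
  have hker : ∀ v, planeOp g a b (-Complex.I) v = 0 →
      (planeOp (tX V) a b (-Complex.I) ^ q) (1 ⊗ₜ v) ∈ W := by
    let T : Submodule ℂ V := LinearMap.ker (planeOp g a b (-Complex.I)) ⊓
      W.comap ((planeOp (tX V) a b (-Complex.I) ^ q) ∘ₗ TensorProduct.mk ℂ _ V 1)
    intro v hv
    refine (hg.mem_of_planeOp_eq_zero hi j₀ hε (T := T) ?_ (fun t ht => ht.1) ?_ hv).2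
    · exact (Submodule.ne_bot_iff _).2 ⟨v₁, ⟨hv₁', hv₁W⟩, hv₁⟩
    · intro k l hkl hka hkb hla hlb t ht
      refine ⟨?_, ?_⟩
      · change planeOp g a b (-Complex.I) (g k (g l t)) = 0
        rw [hg.plane_anticomm hka hkb, hg.plane_anticomm hla hlb,
          LinearMap.mem_ker.1 ht.1]
        simp
      · have h1 := hinv k l _ ht.2
        have hcomm : ∀ (j : ℕ) (u : MvPolynomial (Fin (2 * m + 1)) ℂ ⊗[ℂ] V),
            rotOp (tX V) (tD V) (tG g) k l ((planeOp (tX V) a b (-Complex.I) ^ j) u) =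
              (planeOp (tX V) a b (-Complex.I) ^ j) (rotOp (tX V) (tD V) (tG g) k l u) := by
          intro j u
          induction j with
          | zero => rfl
          | succ j ih =>
            rw [pow_succ', Module.End.mul_apply, Module.End.mul_apply, ← ih, planeOp_apply,
              map_add, map_smul, h.rot_comm_X hka.symm hla.symm, h.rot_comm_X hkb.symm hlb.symm,
              ← planeOp_apply]
        have h2 : rotOp (tX V) (tD V) (tG g) k l ((1 : MvPolynomial _ ℂ) ⊗ₜ[ℂ] t) =
            (2 : ℂ) • ((1 : MvPolynomial _ ℂ) ⊗ₜ[ℂ] g k (g l t)) := by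
          simp only [rotOp_apply, tD_tmul, tG_tmul, hg.anticomm hkl.symm,
            Derivation.map_one_eq_zero, TensorProduct.zero_tmul, map_zero, sub_self, smul_zero,
            TensorProduct.tmul_neg]
          module
        rw [LinearMap.comp_apply, hcomm, TensorProduct.mk_apply, h2, map_smul] at h1
        have h3 := W.smul_mem (2 : ℂ)⁻¹ h1
        rw [smul_smul, inv_mul_cancel₀ two_ne_zero, one_smul] at h3
        exact h3
  by_contra hne
  obtain ⟨f₀, hf₀, hf₀W⟩ := SetLike.exists_of_lt (lt_of_le_of_ne hW hne)
  obtain ⟨ℓ, hℓ, hℓW⟩ := Submodule.exists_dual_map_eq_bot_of_notMem hf₀W inferInstance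
  have hℓW' : ∀ w ∈ W, ℓ w = 0 := fun w hw => by
    have : ℓ w ∈ W.map ℓ := ⟨w, hw, rfl⟩
    rw [hℓW] at this
    exact this
  obtain ⟨ψ, hψE, hψ⟩ := exists_pairing_eq ℓ q
  -- Subtract a multiple of x to make the representing polynomial monogenic; its values on
  -- monogenics do not change.
  obtain ⟨u, huD, huE⟩ := hd.exists_dirac_sub_vec (by omega)
    (fun u hu => eulerOp_eq_neg hg.dual hu) hψE
  have hpair : ∀ f ∈ monogenic g q,
      pairing _ V (ψ - vecOp (tX _) (tG (dualFamily g)) u) f = ℓ f := by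
    intro f hf
    rw [mem_monogenic] at hf
    rw [map_sub, LinearMap.sub_apply, pairing_vecOp, hf.2, map_zero, sub_zero, hψ f hf.1]
  let W' : Submodule ℂ (MvPolynomial (Fin (2 * m + 1)) ℂ ⊗[ℂ] Module.Dual ℂ V) :=
    monogenic (dualFamily g) q ⊓ W.dualAnnihilator.comap (pairing _ V)
  have hW'mem : ∀ ψ, ψ ∈ W' ↔ ψ ∈ monogenic (dualFamily g) q ∧ ∀ w ∈ W, pairing _ V ψ w = 0 :=
    fun ψ => by rw [Submodule.mem_inf, Submodule.mem_comap, Submodule.mem_dualAnnihilator]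
  have hW'0 : W' ≠ ⊥ := by
    refine (Submodule.ne_bot_iff _).2 ⟨_, (hW'mem _).2 ⟨mem_monogenic.2 ⟨huE, huD⟩,
      fun w hw => by rw [hpair w (hW hw), hℓW' w hw]⟩, fun h0 => hℓ ?_⟩
    rw [← hpair f₀ hf₀, h0]
    simp
  have hW'inv : IsRotInvariant (dualFamily g) W' := by
    intro k l ψ hψ
    rw [hW'mem, mem_monogenic] at hψ ⊢
    refine ⟨⟨?_, ?_⟩, fun w hw => ?_⟩
    · rw [hd.euler_rot, hψ.1.1, map_smul]
    · rw [hd.dirac_rot, hψ.1.2, map_zero]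
    · rw [pairing_rotOp, hψ.2 _ (hinv k l w hw), neg_zero]
  -- On the dual side the opposite sign ε = i is chosen, since only z̄^q pairs with z^q to a nonzero
  -- constant.
  obtain ⟨φ, hφ0, hφ, hφW⟩ := exists_planeOp_pow_mem (by omega) hg.dual hW'0 inf_le_left hW'inv hab
    (ε := Complex.I) Complex.I_sq
  have hφker : ∀ v, planeOp g a b (-Complex.I) v = 0 → φ v = 0 := by
    intro v hv
    have h1 := ((hW'mem _).1 hφW).2 _ (hker v hv)
    have h2 := pairing_planeOp_pow_planeOp_pow hg hab hε q φ v
    rw [neg_neg, h1] at h2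
    refine (mul_eq_zero.1 h2.symm).resolve_left ?_
    exact mul_ne_zero (Nat.cast_ne_zero.2 q.factorial_ne_zero) (pow_ne_zero _ two_ne_zero)
  have hφim : ∀ v, φ (planeOp g a b Complex.I v) = 0 := by
    intro v
    have := LinearMap.congr_fun hφ v
    simpa [planeOp_apply, dualFamily] using this
  refine hφ0 (LinearMap.ext fun v => ?_)
  -- Every v is in ker Γ + im Γ̄: ΓΓ̄v = -Γ̄Γv - 4v, where ΓΓ̄v lies in ker Γ because Γ² = 0. As φ
  -- vanishes on both spaces, φ(v) = 0.
  have h1 := hg.plane_plane (ε := -Complex.I) hab Complex.I v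
  have h2 : planeOp g a b (-Complex.I) (planeOp g a b (-Complex.I) (planeOp g a b Complex.I v)) =
    0 := hg.plane_self hε hab _
  have h3 := hφker _ h2
  rw [h1, map_sub, map_neg, hφim, map_smul, neg_zero, zero_sub, neg_eq_zero, smul_eq_mul,
    neg_mul, Complex.I_mul_I] at h3
  exact (mul_eq_zero.1 h3).resolve_left (by norm_num)

end Monogenic

/-! ### Complex combinations of generators and orthogonality of root directions -/

section Vectors

variable {n : ℕ} {F : Type*} [AddCommGroup F] [Module ℂ F] {X d G : Fin n → Module.End ℂ F}

/-- The linear combination `∑ uᵢ Tᵢ`. -/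
def vecComb (T : Fin n → Module.End ℂ F) (u : Fin n → ℂ) : Module.End ℂ F := ∑ i, u i • T i

theorem vecComb_apply (T : Fin n → Module.End ℂ F) (u : Fin n → ℂ) (f : F) :
    vecComb T u f = ∑ i, u i • T i f := by simp [vecComb]

theorem vecComb_vecComb (S T : Fin n → Module.End ℂ F) (u v : Fin n → ℂ) (f : F) :
    vecComb S u (vecComb T v f) = ∑ k, ∑ l, (u k * v l) • S k (T l f) := by
  simp only [vecComb_apply, map_sum, map_smul, Finset.smul_sum, smul_smul]
  rw [Finset.sum_comm]
  exact Finset.sum_congr rfl fun k _ => Finset.sum_congr rfl fun l _ => by rw [mul_comm]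

theorem IsCliffordFamily.vecComb_anticomm (h : IsCliffordFamily G) {u v : Fin n → ℂ}
    (huv : ∑ i, u i * v i = 0) (f : F) :
    vecComb G u (vecComb G v f) = -vecComb G v (vecComb G u f) := by
  rw [vecComb_vecComb, vecComb_vecComb G G v u,
    Finset.sum_comm (f := fun k l => (v k * u l) • G k (G l f))]
  have : ∑ k, ∑ l, (u k * v l) • (if k = l then (-2 : ℂ) • f else 0) = 0 := by
    simp only [smul_ite, smul_zero, Finset.sum_ite_eq, Finset.mem_univ, if_true]
    rw [← Finset.sum_smul, huv, zero_smul]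
  rw [eq_neg_iff_add_eq_zero, ← this, ← Finset.sum_add_distrib]
  refine Finset.sum_congr rfl fun k _ => ?_
  rw [← Finset.sum_add_distrib]
  refine Finset.sum_congr rfl fun l _ => ?_
  rw [h k l f]
  module

theorem WeylClifford.vecComb_d_X (h : WeylClifford X d G) (u : Fin n → ℂ) (i : Fin n) (f : F) :
    vecComb d u (X i f) = X i (vecComb d u f) + u i • f := by
  simp only [vecComb_apply, h.d_X, smul_add, Finset.sum_add_distrib, map_sum, map_smul]
  simp

theorem WeylClifford.vecComb_G_X (h : WeylClifford X d G) (u : Fin n → ℂ) (i : Fin n) (f : F) :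
    vecComb G u (X i f) = X i (vecComb G u f) := by
  simp only [vecComb_apply, h.G_X, map_sum, map_smul]

theorem sum_smul_rotOp (u v : Fin n → ℂ) (f : F) :
    ∑ k, ∑ l, (u k * v l) • rotOp X d G k l f =
      (4 : ℂ) • (vecComb X v (vecComb d u f) - vecComb X u (vecComb d v f)) +
        (vecComb G u (vecComb G v f) - vecComb G v (vecComb G u f)) := by
  rw [vecComb_vecComb X d v u, vecComb_vecComb G G v u,
    Finset.sum_comm (f := fun k l => (v k * u l) • X k (d l f)),
    Finset.sum_comm (f := fun k l => (v k * u l) • G k (G l f)), vecComb_vecComb, vecComb_vecComb]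
  simp only [Finset.smul_sum, ← Finset.sum_add_distrib, ← Finset.sum_sub_distrib]
  refine Finset.sum_congr rfl fun k _ => Finset.sum_congr rfl fun l _ => ?_
  rw [rotOp_apply]
  module

variable {m : ℕ} {S : Fin (2 * m + 1) → Module.End ℂ F}

theorem vecComb_wPos (j : Fin m) :
    vecComb S (wPos j) = planeOp S (idxA j) (idxB j) (-Complex.I) := by
  simp only [vecComb, planeOp, wPos, Pi.sub_apply, Pi.smul_apply, sub_smul, Finset.sum_sub_distrib,
    smul_eq_mul, mul_smul, Pi.single_apply]
  simp [sub_eq_add_neg]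

theorem sum_wPos_mul (j : Fin m) (v : Fin (2 * m + 1) → ℂ) :
    ∑ i, wPos j i * v i = v (idxA j) - Complex.I * v (idxB j) := by
  simp [wPos, sub_mul, Finset.sum_sub_distrib, Pi.single_apply]

theorem sum_wPos_mul_wPos (i j : Fin m) : ∑ k, wPos i k * wPos j k = 0 := by
  rw [sum_wPos_mul]
  by_cases h : i = j
  · subst h
    simp [wPos, idxA, idxB]
  · have h' : (i : ℕ) ≠ j := fun he => h (Fin.ext he)
    simp only [wPos, Pi.sub_apply, Pi.smul_apply, Pi.single_apply, idxA, idxB, Fin.mk.injEq]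
    simp only [show ¬ (2 * (i : ℕ) = 2 * j) by omega, show ¬ (2 * (i : ℕ) = 2 * j + 1) by omega,
      show ¬ (2 * (i : ℕ) + 1 = 2 * j) by omega, show ¬ (2 * (i : ℕ) + 1 = 2 * j + 1) by omega]
    simp

theorem sum_wPos_mul_wNeg {i j : Fin m} (h : i ≠ j) : ∑ k, wPos i k * wNeg j k = 0 := by
  rw [sum_wPos_mul]
  have h' : (i : ℕ) ≠ j := fun he => h (Fin.ext he)
  simp only [wNeg, Pi.add_apply, Pi.smul_apply, Pi.single_apply, idxA, idxB, Fin.mk.injEq]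
  simp only [show ¬ (2 * (i : ℕ) = 2 * j) by omega, show ¬ (2 * (i : ℕ) = 2 * j + 1) by omega,
    show ¬ (2 * (i : ℕ) + 1 = 2 * j) by omega, show ¬ (2 * (i : ℕ) + 1 = 2 * j + 1) by omega]
  simp

theorem sum_wPos_mul_wZero (i : Fin m) : ∑ k, wPos i k * wZero m k = 0 := by
  rw [sum_wPos_mul]
  have := i.2
  simp only [wZero, Pi.single_apply, idxA, idxB, Fin.ext_iff, Fin.val_last]
  rw [if_neg (by omega), if_neg (by omega)]
  simp

end Vectors

/-! ### Reduction to the generators of spin(n); injective intertwiners -/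

section Representations

variable {n : ℕ} {U : Type*} [AddCommGroup U] [Module ℂ U]

theorem spinLie_induction {p : spinLie n → Prop} (br : ∀ k l, p (br k l)) (zero : p 0)
    (add : ∀ A B, p A → p B → p (A + B)) (smul : ∀ (c : ℝ) A, p A → p (c • A)) (A : spinLie n) :
    p A := by
  obtain ⟨A, hA⟩ := A
  change A ∈ Submodule.span ℝ _ at hA
  induction hA using Submodule.span_induction with
  | zero => exact zero
  | add a b ha hb h₁ h₂ => exact add ⟨a, ha⟩ ⟨b, hb⟩ h₁ h₂
  | smul c a ha h => exact smul c ⟨a, ha⟩ h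
  | mem a ha =>
    obtain ⟨⟨k, l⟩, rfl⟩ := ha
    exact br k l

theorem spinRep_smul_apply (ρ : SpinRep n U) (c : ℝ) (A : spinLie n) (f : U) :
    ρ (c • A) f = (c : ℂ) • ρ A f := by
  rw [map_smul]; rfl

theorem spinRep_mem_of_br {ρ : SpinRep n U} {W : Submodule ℂ U}
    (h : ∀ k l, ∀ w ∈ W, ρ (br k l) w ∈ W) (A : spinLie n) : ∀ w ∈ W, ρ A w ∈ W := by
  induction A using spinLie_induction with
  | br k l => exact h k l
  | zero => simp
  | add A B h₁ h₂ =>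
    intro w hw
    rw [map_add]
    exact W.add_mem (h₁ w hw) (h₂ w hw)
  | smul c A h₁ =>
    intro w hw
    rw [spinRep_smul_apply]
    exact W.smul_mem _ (h₁ w hw)

theorem spinRep_comm_of_br {ρ : SpinRep n U} {T : Module.End ℂ U}
    (h : ∀ k l f, T (ρ (br k l) f) = ρ (br k l) (T f)) (A : spinLie n) :
    ∀ f, T (ρ A f) = ρ A (T f) := by
  induction A using spinLie_induction with
  | br k l => exact h k l
  | zero => simp
  | add A B h₁ h₂ =>
    intro f
    rw [map_add, LinearMap.add_apply, LinearMap.add_apply, map_add, h₁, h₂]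
  | smul c A h₁ =>
    intro f
    rw [spinRep_smul_apply, spinRep_smul_apply, map_smul, h₁]

theorem IsIrreducibleOn.map {ρ : SpinRep n U} {W : Submodule ℂ U} (hW : IsIrreducibleOn ρ W)
    {T : Module.End ℂ U} (hT : ∀ A f, T (ρ A f) = ρ A (T f)) (hinj : ∀ w ∈ W, T w = 0 → w = 0) :
    IsIrreducibleOn ρ (W.map T) where
  ne_bot h := by
    obtain ⟨w, hw, hw0⟩ := (Submodule.ne_bot_iff _).1 hW.ne_bot
    refine hw0 (hinj w hw ?_)
    have : T w ∈ W.map T := ⟨w, hw, rfl⟩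
    rwa [h] at this
  invariant := by
    rintro A _ ⟨w, hw, rfl⟩
    exact ⟨ρ A w, hW.invariant A w hw, hT A w⟩
  eq_bot_or_eq W' hW' hinv := by
    rcases hW.eq_bot_or_eq (W ⊓ W'.comap T) inf_le_left (fun A w hw =>
      ⟨hW.invariant A w hw.1, by
        change T (ρ A w) ∈ W'
        rw [hT]
        exact hinv A _ hw.2⟩) with h | h
    · left
      refine (Submodule.eq_bot_iff _).2 fun u hu => ?_
      obtain ⟨w, hw, rfl⟩ := hW' hu
      have : w ∈ W ⊓ W'.comap T := ⟨hw, hu⟩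
      rw [h] at this
      rw [(Submodule.mem_bot ℂ).1 this, map_zero]
    · right
      refine le_antisymm hW' ?_
      rintro _ ⟨w, hw, rfl⟩
      rw [← h] at hw
      exact hw.2

theorem IsIrrepOfHighestWeight.map {m : ℕ} {ρ : SpinRep (2 * m + 1) U} {wt : Fin m → ℝ}
    {W : Submodule ℂ U} (hW : IsIrrepOfHighestWeight ρ wt W) {T : Module.End ℂ U}
    (hT : ∀ A f, T (ρ A f) = ρ A (T f)) (hinj : ∀ w ∈ W, T w = 0 → w = 0) :
    IsIrrepOfHighestWeight ρ wt (W.map T) := by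
  obtain ⟨hirr, v, hv, h⟩ := hW
  have hbr : ∀ x y f, T (brC ρ x y f) = brC ρ x y (T f) := fun x y f => by
    simp [brC, hT]
  refine ⟨hirr.map hT hinj, T v, ⟨v, hv, rfl⟩, fun h0 => h.ne_zero (hinj v hv h0), fun j => ?_,
    fun i j hij => ?_, fun i j hij => ?_, fun i => ?_⟩
  · rw [← hT, h.weight, map_smul]
  · rw [← hbr, h.root_add i j hij, map_zero]
  · rw [← hbr, h.root_sub i j hij, map_zero]
  · rw [← hbr, h.root_short, map_zero]

theorem isQuotientOf_of_sup_eq {W₀ W₁ H K : Submodule ℂ U} (hdis : Disjoint W₀ W₁)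
    (hsup : W₀ ⊔ W₁ = H) (hK : W₀ = H ⊓ K) : IsQuotientOf W₁ H K := by
  refine ⟨hsup ▸ le_sup_right, ?_, ?_⟩
  · rw [← LinearMap.ker_eq_bot, LinearMap.ker_eq_bot']
    intro w hw
    rw [LinearMap.comp_apply, Submodule.mkQ_apply, Submodule.Quotient.mk_eq_zero,
      Submodule.submoduleOf, Submodule.mem_comap] at hw
    have h0 : (w : U) ∈ W₀ := hK ▸ ⟨hsup ▸ (le_sup_right : W₁ ≤ W₀ ⊔ W₁) w.2, hw⟩
    exact Subtype.ext (Submodule.disjoint_def.1 hdis _ h0 w.2)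
  · intro y
    obtain ⟨⟨f, hf⟩, rfl⟩ := Submodule.mkQ_surjective _ y
    rw [← hsup] at hf
    obtain ⟨f₀, h₀, f₁, h₁, rfl⟩ := Submodule.mem_sup.1 hf
    refine ⟨⟨f₁, h₁⟩, ?_⟩
    rw [LinearMap.comp_apply, Submodule.mkQ_apply, Submodule.mkQ_apply, Submodule.Quotient.eq,
      Submodule.submoduleOf, Submodule.mem_comap]
    rw [hK] at h₀
    have : f₁ - (f₀ + f₁) = -f₀ := by abel
    change f₁ - (f₀ + f₁) ∈ K
    rw [this]
    exact K.neg_mem h₀.2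

end Representations

/-! ### Identification of the Clifford module operators with the abstract ones -/

section Translation

variable {n : ℕ} {V : Type*} [AddCommGroup V] [Module ℂ V] (γ : Cl n →ₐ[ℝ] Module.End ℂ V)

/-- Clifford multiplication by the standard basis vectors. -/
noncomputable def cliffordFamily (i : Fin n) : Module.End ℂ V := γ (e i)

theorem isCliffordFamily_cliffordFamily : IsCliffordFamily (cliffordFamily γ) := by
  intro i j v
  have h := congrArg (fun a => γ a v) (e_mul_e_add (n := n) i j)
  simp only [map_add, map_mul, AlgHom.commutes] at h
  change γ (e i) (γ (e j) v) + γ (e j) (γ (e i) v) = _ at h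
  change γ (e i) (γ (e j) v) = -γ (e j) (γ (e i) v) + _
  rw [eq_neg_add_iff_add_eq, add_comm, h, Module.algebraMap_end_apply]
  split_ifs with hij
  · change ((-2 : ℝ) : ℂ) • v = _
    norm_num
  · simp

theorem isIrreducibleFamily_cliffordFamily {γ : Cl n →ₐ[ℝ] Module.End ℂ V}
    (hγ : IsSpinorModule γ) : IsIrreducibleFamily (cliffordFamily γ) := by
  intro W hW
  refine hγ.eq_bot_or_eq_top W fun a => ?_
  induction a using CliffordAlgebra.induction with
  | algebraMap r =>
    intro w hw
    rw [AlgHom.commutes, Module.algebraMap_end_apply]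
    exact W.smul_mem (r : ℂ) hw
  | ι x =>
    intro w hw
    have : CliffordAlgebra.ι (negForm n) x = ∑ i, x i • e i := by
      conv_lhs => rw [pi_eq_sum_univ' x]
      rw [map_sum]
      refine Finset.sum_congr rfl fun i _ => ?_
      rw [map_smul, e]
    rw [this, map_sum, LinearMap.sum_apply]
    refine W.sum_mem fun i _ => ?_
    rw [map_smul]
    exact W.smul_mem (x i : ℂ) (hW i w hw)
  | mul a b ha hb =>
    intro w hw
    rw [map_mul]
    exact ha _ (hb w hw)
  | add a b ha hb =>
    intro w hw
    rw [map_add]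
    exact W.add_mem (ha w hw) (hb w hw)

theorem dirac_eq : dirac γ = diracOp (tD V) (tG (cliffordFamily γ)) :=
  TensorProduct.ext' fun p v => by simp [dirac, diracOp_apply, cliffordFamily]

theorem cliffordX_eq : cliffordX γ = vecOp (tX V) (tG (cliffordFamily γ)) :=
  TensorProduct.ext' fun p v => by simp [cliffordX, vecOp_apply, cliffordFamily]

theorem spinorRep_br (k l : Fin n) (v : V) : spinorRep γ (br k l) v =
    cliffordFamily γ k (cliffordFamily γ l v) - cliffordFamily γ l (cliffordFamily γ k v) := by
  change γ ⁅(e k : Cl n), e l⁆ v = _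
  rw [Ring.lie_def, map_sub, map_mul, map_mul]
  rfl

theorem spinorPolyRep_br (k l : Fin n) : spinorPolyRep γ (br k l) =
    rotOp (tX V) (tD V) (tG (cliffordFamily γ)) k l := by
  refine TensorProduct.ext' fun p v => ?_
  change polyRep n (br k l) p ⊗ₜ v + p ⊗ₜ spinorRep γ (br k l) v = _
  rw [polyRep_br, spinorRep_br, rotOp_apply]
  have h4 : (4 : MvPolynomial (Fin n) ℂ) = MvPolynomial.C 4 := (map_ofNat _ 4).symm
  simp only [tD_tmul, tX_tmul, tG_tmul]
  rw [h4, ← MvPolynomial.smul_eq_C_mul, ← TensorProduct.sub_tmul, TensorProduct.smul_tmul',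
    ← TensorProduct.tmul_sub, neg_add_eq_sub]

theorem isRotInvariant_of_invariant {W : Submodule ℂ (MvPolynomial (Fin n) ℂ ⊗[ℂ] V)}
    (h : ∀ A, ∀ w ∈ W, spinorPolyRep γ A w ∈ W) : IsRotInvariant (cliffordFamily γ) W :=
  fun k l w hw => by rw [← spinorPolyRep_br]; exact h _ w hw

theorem brC_spinorPolyRep (u v : Fin n → ℂ) (f : MvPolynomial (Fin n) ℂ ⊗[ℂ] V) :
    brC (spinorPolyRep γ) u v f =
      (4 : ℂ) • (vecComb (tX V) v (vecComb (tD V) u f) - vecComb (tX V) u (vecComb (tD V) v f)) +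
        (vecComb (tG (cliffordFamily γ)) u (vecComb (tG (cliffordFamily γ)) v f) -
          vecComb (tG (cliffordFamily γ)) v (vecComb (tG (cliffordFamily γ)) u f)) := by
  rw [← sum_smul_rotOp]
  simp [brC, spinorPolyRep_br]

theorem brC_spinorRep (u v : Fin n → ℂ) (f : V) :
    brC (spinorRep γ) u v f =
      vecComb (cliffordFamily γ) u (vecComb (cliffordFamily γ) v f) -
        vecComb (cliffordFamily γ) v (vecComb (cliffordFamily γ) u f) := by
  rw [vecComb_vecComb, vecComb_vecComb,
    Finset.sum_comm (f := fun k l => (v k * u l) • cliffordFamily γ k (cliffordFamily γ l f)),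
    ← Finset.sum_sub_distrib]
  simp only [← Finset.sum_sub_distrib, brC, LinearMap.sum_apply, LinearMap.smul_apply,
    spinorRep_br]
  refine Finset.sum_congr rfl fun k _ => Finset.sum_congr rfl fun l _ => ?_
  module

end Translation

/-! ### Highest weight vectors of the spinors and of the monogenics -/

section HighestWeight

variable {m : ℕ} {V : Type*} [AddCommGroup V] [Module ℂ V]
  {γ : Cl (2 * m + 1) →ₐ[ℝ] Module.End ℂ V}

theorem idxA_ne_idxB (i j : Fin m) : idxA i ≠ idxB j := by
  simp only [idxA, idxB, ne_eq, Fin.mk.injEq]; omega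

theorem idxA_ne_idxA {i j : Fin m} (h : i ≠ j) : idxA i ≠ idxA j := by
  have : (i : ℕ) ≠ j := fun he => h (Fin.ext he)
  simp only [idxA, ne_eq, Fin.mk.injEq]; omega

theorem idxB_ne_idxB {i j : Fin m} (h : i ≠ j) : idxB i ≠ idxB j := by
  have : (i : ℕ) ≠ j := fun he => h (Fin.ext he)
  simp only [idxB, ne_eq, Fin.mk.injEq]; omega

theorem spinorRep_weight_of_vacuum {v : V} (j : Fin m)
    (hv : planeOp (cliffordFamily γ) (idxA j) (idxB j) (-Complex.I) v = 0) :
    spinorRep γ (br (idxA j) (idxB j)) v = (2 * Complex.I) • v := by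
  have hg := isCliffordFamily_cliffordFamily γ
  rw [planeOp_apply, neg_smul, add_neg_eq_zero] at hv
  rw [spinorRep_br, hg.anticomm (idxA_ne_idxB j j), hv, map_smul, hg.self]
  module

theorem isIrrepOfHighestWeight_spinorRep [FiniteDimensional ℂ V] (hγ : IsSpinorModule γ) :
    IsIrrepOfHighestWeight (spinorRep γ) (wtSpin m) ⊤ := by
  have := hγ.nontrivial
  have hg := isCliffordFamily_cliffordFamily γ
  refine ⟨⟨top_ne_bot, fun _ _ _ => Submodule.mem_top, fun W _ hW => ?_⟩, ?_⟩
  · refine hg.eq_bot_or_eq_top (isIrreducibleFamily_cliffordFamily hγ) fun k l hkl w hw => ?_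
    have h := W.smul_mem (1 / 2 : ℂ) (hW (br k l) w hw)
    rw [spinorRep_br, hg.anticomm hkl.symm] at h
    convert h using 1
    module
  · obtain ⟨v, hv, hvac⟩ := hg.exists_vacuum
    -- A root vector [w_i, u] with u orthogonal to w_i acts as 2 w_i u = -2 u w_i, and w_i kills the
    -- vacuum.
    have hroot : ∀ i u, ∑ k, wPos i k * u k = 0 → brC (spinorRep γ) (wPos i) u v = 0 := by
      intro i u hu
      rw [brC_spinorRep, hg.vecComb_anticomm hu, vecComb_wPos, hvac, map_zero, neg_zero, sub_zero]
    refine ⟨v, Submodule.mem_top, hv, fun j => ?_, fun i j _ => hroot i _ (sum_wPos_mul_wPos i j),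
      fun i j hij => hroot i _ (sum_wPos_mul_wNeg hij.ne), fun i => hroot i _ (sum_wPos_mul_wZero i)⟩
    rw [spinorRep_weight_of_vacuum j (hvac j), wtSpin]
    push_cast
    congr 1
    ring

/-- Each factor z adds 1 to the first weight, and the vacuum supplies 1/2 in every entry. For a
positive root vector [w_i, u], both w_i and u are orthogonal to the gradient direction w₁ of z, so
the orbital part kills z^q v; the spin part does so as for the vacuum. -/
theorem isHighestWeightVector_planeOp_pow (hm : 1 ≤ m) (q : ℕ) {v : V} (hv : v ≠ 0)
    (hvac : ∀ j, planeOp (cliffordFamily γ) (idxA j) (idxB j) (-Complex.I) v = 0) :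
    IsHighestWeightVector (spinorPolyRep γ) (wtHook m (q + 1 / 2))
      ((planeOp (tX V) (idxA ⟨0, hm⟩) (idxB ⟨0, hm⟩) (-Complex.I) ^ q) (1 ⊗ₜ v)) := by
  have hg := isCliffordFamily_cliffordFamily γ
  have h := hg.weylClifford
  have hε : (-Complex.I) ^ 2 = -1 := by rw [neg_sq, Complex.I_sq]
  let j₀ : Fin m := ⟨0, hm⟩
  change IsHighestWeightVector _ _
    ((planeOp (tX V) (idxA j₀) (idxB j₀) (-Complex.I) ^ q) (1 ⊗ₜ v))
  obtain ⟨Z, hZ⟩ : ∃ Z, planeOp (tX V) (idxA j₀) (idxB j₀) (-Complex.I) = Z := ⟨_, rfl⟩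
  have hZinj : Function.Injective (Z ^ q) := by
    rw [Module.End.coe_pow, ← hZ]
    exact (planeOp_tX_injective (idxA_ne_idxB _ _) _).iterate q
  have hshift : ∀ (T : Module.End ℂ (MvPolynomial (Fin (2 * m + 1)) ℂ ⊗[ℂ] V)) (c : ℂ),
      (∀ f, T (Z f) = Z (T f) + c • Z f) → ∀ (j : ℕ) f,
      T ((Z ^ j) f) = (Z ^ j) (T f) + (j * c) • (Z ^ j) f := by
    intro T c hT j f
    induction j with
    | zero => simp
    | succ j ih =>
      rw [pow_succ', Module.End.mul_apply, Module.End.mul_apply, hT, ih, map_add, map_smul]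
      push_cast
      module
  have hd : ∀ u, u (idxA j₀) - Complex.I * u (idxB j₀) = 0 →
      vecComb (tD V) u ((Z ^ q) (1 ⊗ₜ v)) = 0 := by
    intro u hu
    rw [hshift _ 0 _ q]
    · simp [vecComb_apply]
    · intro f
      rw [← hZ, planeOp_apply, map_add, map_smul, h.vecComb_d_X, h.vecComb_d_X, planeOp_apply]
      have : u (idxA j₀) = Complex.I * u (idxB j₀) := sub_eq_zero.1 hu
      rw [this]
      module
  have hroot : ∀ i u, ∑ k, wPos i k * u k = 0 → u (idxA j₀) - Complex.I * u (idxB j₀) = 0 →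
      brC (spinorPolyRep γ) (wPos i) u ((Z ^ q) (1 ⊗ₜ v)) = 0 := by
    intro i u hu hu₀
    have hG : vecComb (tG (cliffordFamily γ)) (wPos i) ((Z ^ q) (1 ⊗ₜ v)) = 0 := by
      rw [hshift _ 0 _ q]
      · have : vecComb (tG (cliffordFamily γ)) (wPos i)
            ((1 : MvPolynomial (Fin (2 * m + 1)) ℂ) ⊗ₜ[ℂ] v) =
            1 ⊗ₜ planeOp (cliffordFamily γ) (idxA i) (idxB i) (-Complex.I) v := by
          rw [vecComb_wPos, planeOp_apply, planeOp_apply, TensorProduct.tmul_add,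
            TensorProduct.tmul_smul]
          rfl
        rw [this, hvac]
        simp
      · intro f
        rw [← hZ, planeOp_apply, map_add, map_smul, h.vecComb_G_X, h.vecComb_G_X, planeOp_apply]
        module
    rw [brC_spinorPolyRep, hd u hu₀, hd (wPos i), h.isCliffordFamily.vecComb_anticomm hu, hG]
    · simp
    · rw [← sum_wPos_mul, sum_wPos_mul_wPos]
  rw [hZ]
  refine ⟨fun h0 => hv (one_tmul_injective (hZinj (h0.trans (map_zero _).symm))), fun j => ?_,
    fun i j _ => hroot i _ (sum_wPos_mul_wPos i j) ?_,
    fun i j hij => hroot i _ (sum_wPos_mul_wNeg hij.ne) ?_,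
    fun i => hroot i _ (sum_wPos_mul_wZero i) ?_⟩
  -- The shift is -4ε with ε = -i, that is 4i, in the plane of z, and 0 in the other planes.
  · rw [hshift _ (if j = j₀ then 4 * Complex.I else 0) _ q]
    · have : spinorPolyRep γ (br (idxA j) (idxB j))
          ((1 : MvPolynomial (Fin (2 * m + 1)) ℂ) ⊗ₜ[ℂ] v) = (2 * Complex.I) • 1 ⊗ₜ v := by
        change polyRep _ _ 1 ⊗ₜ v + 1 ⊗ₜ spinorRep γ _ v = _
        rw [polyRep_br, spinorRep_weight_of_vacuum j (hvac j), TensorProduct.tmul_smul]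
        simp
      rw [this, map_smul, ← add_smul, wtHook]
      congr 1
      by_cases hj : j = j₀
      · rw [if_pos hj, if_pos (by rw [hj])]
        push_cast
        ring
      · rw [if_neg hj, if_neg fun h => hj (Fin.ext h)]
        push_cast
        ring
    · intro f
      rw [spinorPolyRep_br, ← hZ]
      by_cases hj : j = j₀
      · rw [if_pos hj, hj, h.rot_plane_X hε (idxA_ne_idxB _ _)]
        congr 2
        ring
      · rw [if_neg hj, zero_smul, add_zero, planeOp_apply, map_add, map_smul,
          h.rot_comm_X (idxA_ne_idxA (Ne.symm hj)) (idxA_ne_idxB _ _),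
          h.rot_comm_X (idxA_ne_idxB _ _).symm (idxB_ne_idxB (Ne.symm hj)), planeOp_apply]
  · rw [← sum_wPos_mul, sum_wPos_mul_wPos]
  · rw [← sum_wPos_mul, sum_wPos_mul_wNeg]
    exact Fin.ne_of_lt (lt_of_le_of_lt (Nat.zero_le (i : ℕ)) hij)
  · rw [← sum_wPos_mul, sum_wPos_mul_wZero]

/-- Dz = zD + Γ, and Γ commutes with z and kills v. -/
theorem planeOp_pow_mem_monogenic {a b : Fin (2 * m + 1)} {ε : ℂ}
    (q : ℕ) {v : V} (hv : planeOp (cliffordFamily γ) a b ε v = 0) :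
    (planeOp (tX V) a b ε ^ q) (1 ⊗ₜ v) ∈ monogenic (cliffordFamily γ) q := by
  have h := (isCliffordFamily_cliffordFamily γ).weylClifford
  rw [mem_monogenic]
  induction q with
  | zero => simp [eulerOp_apply, diracOp_apply]
  | succ q ih =>
    have hG : planeOp (tG (cliffordFamily γ)) a b ε ((planeOp (tX V) a b ε ^ q) (1 ⊗ₜ v)) = 0 := by
      clear ih
      induction q with
      | zero =>
        rw [pow_zero, Module.End.one_apply, planeOp_apply, tG_tmul, tG_tmul,
          ← TensorProduct.tmul_smul, ← TensorProduct.tmul_add, ← planeOp_apply, hv,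
          TensorProduct.tmul_zero]
      | succ q ih => rw [pow_succ', Module.End.mul_apply, h.plane_plane_G_X, ih, map_zero]
    rw [pow_succ', Module.End.mul_apply]
    obtain ⟨h1, h2⟩ := ih
    constructor
    · rw [planeOp_apply, map_add, map_smul, h.euler_X, h.euler_X, h1]
      push_cast
      simp only [map_smul]
      module
    · rw [planeOp_apply, map_add, map_smul, h.dirac_X, h.dirac_X, h2, map_zero, map_zero, zero_add,
        zero_add, ← planeOp_apply, hG]

theorem isRotInvariant_monogenic {n : ℕ} {g : Fin n → Module.End ℂ V} (hg : IsCliffordFamily g)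
    (q : ℕ) : IsRotInvariant g (monogenic g q) := by
  have h := hg.weylClifford
  intro k l f hf
  rw [mem_monogenic] at hf ⊢
  rw [h.euler_rot, h.dirac_rot, hf.1, hf.2, map_smul, map_zero]
  exact ⟨rfl, rfl⟩

theorem isIrrepOfHighestWeight_monogenic [FiniteDimensional ℂ V] (hm : 1 ≤ m)
    (hγ : IsSpinorModule γ) (q : ℕ) :
    IsIrrepOfHighestWeight (spinorPolyRep γ) (wtHook m (q + 1 / 2))
      (monogenic (cliffordFamily γ) q) := by
  have := hγ.nontrivial
  have hg := isCliffordFamily_cliffordFamily γ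
  obtain ⟨v, hv, hvac⟩ := hg.exists_vacuum
  have hmem := planeOp_pow_mem_monogenic (γ := γ) q (hvac ⟨0, hm⟩)
  have hhw := isHighestWeightVector_planeOp_pow hm q hv hvac
  refine ⟨⟨(Submodule.ne_bot_iff _).2 ⟨_, hmem, hhw.ne_zero⟩, spinRep_mem_of_br fun k l w hw => ?_,
    fun W hW hinv => or_iff_not_imp_left.2 fun hW0 => eq_monogenic_of_isRotInvariant hm hg
      (isIrreducibleFamily_cliffordFamily hγ) hW0 hW (isRotInvariant_of_invariant γ hinv)⟩,
    _, hmem, hhw⟩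
  rw [spinorPolyRep_br]
  exact isRotInvariant_monogenic hg q k l w hw

end HighestWeight

/-! ### Existence of the decomposition and analysis of an arbitrary one -/

section Decomposition

variable {m : ℕ} {V : Type*} [AddCommGroup V] [Module ℂ V]
  {γ : Cl (2 * m + 1) →ₐ[ℝ] Module.End ℂ V}

theorem dirac_vec_of_mem_monogenic {n : ℕ} {g : Fin n → Module.End ℂ V} (hg : IsCliffordFamily g)
    {q : ℕ} {f : MvPolynomial (Fin n) ℂ ⊗[ℂ] V} (hf : f ∈ monogenic g q) :
    diracOp (tD V) (tG g) (vecOp (tX V) (tG g) f) = (-(2 * q + n) : ℂ) • f := by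
  rw [mem_monogenic] at hf
  rw [hg.weylClifford.dirac_vec, hf.1, hf.2, map_zero]
  module

theorem dirac_mem_monogenic {n : ℕ} {g : Fin n → Module.End ℂ V} (hg : IsCliffordFamily g)
    {q : ℕ} {f : MvPolynomial (Fin n) ℂ ⊗[ℂ] V} (hf : f ∈ harmonicTensor n (q + 1) V) :
    diracOp (tD V) (tG g) f ∈ monogenic g q := by
  rw [mem_harmonicTensor] at hf
  rw [mem_monogenic, hg.weylClifford.dirac_dirac, hf.2, neg_zero,
    hg.weylClifford.euler_dirac_of_eq hf.1]
  push_cast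
  rw [add_sub_cancel_right]
  exact ⟨rfl, rfl⟩

theorem vec_mem_harmonicTensor {n : ℕ} {g : Fin n → Module.End ℂ V} (hg : IsCliffordFamily g)
    {q : ℕ} {f : MvPolynomial (Fin n) ℂ ⊗[ℂ] V} (hf : f ∈ monogenic g q) :
    vecOp (tX V) (tG g) f ∈ harmonicTensor n (q + 1) V := by
  have hf' := mem_monogenic.1 hf
  rw [mem_harmonicTensor, hg.weylClifford.euler_vec_of_eq hf'.1,
    ← neg_neg (lapOp _ _), ← hg.weylClifford.dirac_dirac, dirac_vec_of_mem_monogenic hg hf, map_smul,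
    hf'.2, smul_zero, neg_zero]
  push_cast
  exact ⟨rfl, rfl⟩

theorem two_mul_add_ne_zero (q m : ℕ) : (-(2 * q + (2 * m + 1 : ℕ)) : ℂ) ≠ 0 := by
  rw [neg_ne_zero]
  exact_mod_cast (by omega : 2 * q + (2 * m + 1) ≠ 0)

theorem exists_isSpinorDecomposition [FiniteDimensional ℂ V] (hm : 1 ≤ m) (hγ : IsSpinorModule γ)
    (q : ℕ) : ∃ W₀ W₁, IsSpinorDecomposition γ q W₀ W₁ := by
  have hg := isCliffordFamily_cliffordFamily γ
  have h := hg.weylClifford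
  have hle : ∀ q, monogenic (cliffordFamily γ) q ≤ harmonicTensor (2 * m + 1) q V := fun q => by
    rw [monogenic_eq hg]; exact inf_le_left
  have hirr := isIrrepOfHighestWeight_monogenic hm hγ
  cases q with
  | zero =>
    refine ⟨monogenic (cliffordFamily γ) 0, ⊥, hirr 0, fun h0 => absurd h0 (by norm_num),
      fun _ => rfl, disjoint_bot_right, ?_⟩
    rw [sup_bot_eq]
    refine le_antisymm (hle 0) fun f hf => ?_
    have hE := (mem_harmonicTensor.1 hf).1
    -- In degree 0, Df would have degree -1, so it vanishes and everything is monogenic.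
    refine mem_monogenic.2 ⟨hE, eulerOp_eq_neg hg ?_⟩
    rw [h.euler_dirac_of_eq hE]
    simp
  | succ p =>
    let x := vecOp (tX V) (tG (cliffordFamily γ))
    have hDx : ∀ f ∈ monogenic (cliffordFamily γ) p, diracOp (tD V) (tG (cliffordFamily γ)) (x f) =
        (-(2 * p + (2 * m + 1 : ℕ)) : ℂ) • f := fun f hf => dirac_vec_of_mem_monogenic hg hf
    have hinj : ∀ f ∈ monogenic (cliffordFamily γ) p,
        diracOp (tD V) (tG (cliffordFamily γ)) (x f) = 0 → f = 0 := by
      intro f hf h0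
      rw [hDx f hf] at h0
      exact (smul_eq_zero.1 h0).resolve_left (two_mul_add_ne_zero p m)
    refine ⟨monogenic (cliffordFamily γ) (p + 1), (monogenic (cliffordFamily γ) p).map x,
      hirr (p + 1), fun _ => ?_, fun h0 => absurd h0 p.succ_ne_zero, ?_, ?_⟩
    · have := (hirr p).map (T := x) (spinRep_comm_of_br fun k l f => by
        rw [spinorPolyRep_br]; exact h.vec_rot k l f)
        fun w hw h0 => hinj w hw (by rw [h0, map_zero])
      convert this using 2
      push_cast
      ring
    · rw [Submodule.disjoint_def]
      rintro _ hf ⟨f, hf', rfl⟩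
      rw [hinj f hf' (mem_monogenic.1 hf).2, map_zero]
    · refine le_antisymm (sup_le (hle _) ?_) fun f hf => ?_
      · rintro _ ⟨f, hf, rfl⟩
        exact vec_mem_harmonicTensor hg hf
      · have hD := dirac_mem_monogenic hg hf
        -- The scalar is the inverse of Dx on the monogenics of degree p, so Dxu = Df.
        let u := (-(2 * p + (2 * m + 1 : ℕ)) : ℂ)⁻¹ • diracOp (tD V) (tG (cliffordFamily γ)) f
        have hu : u ∈ monogenic (cliffordFamily γ) p := Submodule.smul_mem _ _ hD
        have hfu : f - x u ∈ monogenic (cliffordFamily γ) (p + 1) := by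
          rw [monogenic_eq hg]
          refine ⟨Submodule.sub_mem _ hf (vec_mem_harmonicTensor hg hu), ?_⟩
          change diracOp _ _ (f - x u) = 0
          rw [map_sub, hDx u hu, smul_inv_smul₀ (two_mul_add_ne_zero p m),
            sub_self]
        rw [← sub_add_cancel f (x u)]
        exact Submodule.add_mem_sup hfu ⟨u, hu, rfl⟩

/-- Weight vectors of weight `q + 1/2` of degree `q` are monogenic. -/
theorem dirac_eq_zero_of_weight {q : ℕ} (j : Fin m) {f : MvPolynomial (Fin (2 * m + 1)) ℂ ⊗[ℂ] V}
    (hf : f ∈ harmonicTensor (2 * m + 1) q V)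
    (hL : spinorPolyRep γ (br (idxA j) (idxB j)) f =
      (4 * Complex.I * ((q + 1 / 2 : ℝ) : ℂ)) • f) :
    diracOp (tD V) (tG (cliffordFamily γ)) f = 0 := by
  have hg := isCliffordFamily_cliffordFamily γ
  have h := hg.weylClifford
  -- Applied to Df, whose degree q - 1 is taken as a real number so that q = 0 needs no separate
  -- case.
  refine h.eq_zero_of_weight (idxA_ne_idxB j j) (fun c hc u hu => countOp_add_smul_eq_zero hg
    (idxA_ne_idxB j j) Complex.I_sq hc hu) (p := q - 1) (μ := q + 1 / 2) (by linarith) ?_ ?_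
  · rw [h.euler_dirac_of_eq (mem_harmonicTensor.1 hf).1]
    push_cast
    rfl
  · rw [← h.dirac_rot, ← spinorPolyRep_br, hL, map_smul]

theorem IsSpinorDecomposition.eq_monogenic [FiniteDimensional ℂ V] (hm : 1 ≤ m)
    (hγ : IsSpinorModule γ) {q : ℕ}
    {W₀ W₁ : Submodule ℂ (MvPolynomial (Fin (2 * m + 1)) ℂ ⊗[ℂ] V)}
    (hdec : IsSpinorDecomposition γ q W₀ W₁) : W₀ = monogenic (cliffordFamily γ) q := by
  have := hγ.nontrivial
  have hg := isCliffordFamily_cliffordFamily γ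
  have h := hg.weylClifford
  have hle : W₀ ≤ harmonicTensor (2 * m + 1) q V := hdec.sup_eq ▸ le_sup_left
  obtain ⟨hirr, v, hv, hhw⟩ := hdec.irrep₀
  -- ker D meets W₀ in an invariant subspace, which contains the highest weight vector.
  have hD : W₀ ⊓ LinearMap.ker (diracOp (tD V) (tG (cliffordFamily γ))) = W₀ := by
    refine (hirr.eq_bot_or_eq _ inf_le_left (spinRep_mem_of_br fun k l w hw =>
      ⟨hirr.invariant _ w hw.1, ?_⟩)).resolve_left fun h0 => ?_
    · change diracOp _ _ _ = 0
      rw [spinorPolyRep_br, h.dirac_rot, LinearMap.mem_ker.1 hw.2, map_zero]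
    · have hL := hhw.weight ⟨0, hm⟩
      rw [wtHook, if_pos rfl] at hL
      have hv0 : v ∈ W₀ ⊓ LinearMap.ker (diracOp (tD V) (tG (cliffordFamily γ))) :=
        ⟨hv, dirac_eq_zero_of_weight ⟨0, hm⟩ (hle hv) hL⟩
      rw [h0] at hv0
      exact hhw.ne_zero hv0
  refine eq_monogenic_of_isRotInvariant hm hg (isIrreducibleFamily_cliffordFamily hγ) hirr.ne_bot ?_
    (isRotInvariant_of_invariant γ hirr.invariant)
  rw [monogenic_eq hg]
  exact le_inf hle (inf_eq_left.1 hD)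

theorem IsSpinorDecomposition.vec_dirac [FiniteDimensional ℂ V] (hm : 1 ≤ m)
    (hγ : IsSpinorModule γ) {q : ℕ}
    {W₀ W₁ : Submodule ℂ (MvPolynomial (Fin (2 * m + 1)) ℂ ⊗[ℂ] V)}
    (hdec : IsSpinorDecomposition γ q W₀ W₁) {f : MvPolynomial (Fin (2 * m + 1)) ℂ ⊗[ℂ] V}
    (hf : f ∈ W₁) : -vecOp (tX V) (tG (cliffordFamily γ))
      (diracOp (tD V) (tG (cliffordFamily γ)) f) =
        (((2 * m + 1 : ℕ) : ℂ) + 2 * (q : ℂ) - 2) • f := by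
  have := hγ.nontrivial
  have hg := isCliffordFamily_cliffordFamily γ
  have h := hg.weylClifford
  rcases Nat.eq_zero_or_pos q with hq | hq
  · rw [hdec.absent hq, Submodule.mem_bot] at hf
    simp [hf]
  have hW₀ := hdec.eq_monogenic hm hγ
  have hle : W₁ ≤ harmonicTensor (2 * m + 1) q V := hdec.sup_eq ▸ le_sup_right
  obtain ⟨hirr, -⟩ := hdec.irrep₁ hq
  obtain ⟨-, v, hv, hhw⟩ := hdec.irrep₀
  let c : ℂ := ((2 * m + 1 : ℕ) : ℂ) + 2 * (q : ℂ) - 2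
  let T : Module.End ℂ (MvPolynomial (Fin (2 * m + 1)) ℂ ⊗[ℂ] V) :=
    vecOp (tX V) (tG (cliffordFamily γ)) * diracOp (tD V) (tG (cliffordFamily γ)) + c • 1
  have hTapp : ∀ u, T u = vecOp (tX V) (tG (cliffordFamily γ))
      (diracOp (tD V) (tG (cliffordFamily γ)) u) + c • u := fun u => rfl
  have hTrot : ∀ k l u, T (spinorPolyRep γ (br k l) u) = spinorPolyRep γ (br k l) (T u) := by
    intro k l u
    rw [spinorPolyRep_br, hTapp, hTapp, h.dirac_rot, h.vec_rot, map_add, map_smul]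
  -- On H^q ⊗ V one has D² = 0, so DT = (-2(q-1) - n + c) D, and c is the value that makes this
  -- zero.
  have hTmem : ∀ u ∈ W₁, T u ∈ monogenic (cliffordFamily γ) q := by
    intro u hu
    have hu' := mem_harmonicTensor.1 (hle hu)
    have hED := h.euler_dirac_of_eq hu'.1
    rw [mem_monogenic, hTapp, map_add, map_add, map_smul, map_smul, h.euler_vec_of_eq hED,
      h.dirac_vec, h.dirac_dirac, hED, hu'.1, hu'.2]
    refine ⟨?_, ?_⟩
    · module
    · rw [neg_zero, map_zero]
      simp only [c]
      module
  have hker : W₁ ⊓ LinearMap.ker T = W₁ := by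
    refine (hirr.eq_bot_or_eq _ inf_le_left (spinRep_mem_of_br fun k l w hw =>
      ⟨hirr.invariant _ w hw.1, ?_⟩)).resolve_left fun h0 => ?_
    · change T _ = 0
      rw [hTrot, LinearMap.mem_ker.1 hw.2, map_zero]
    -- Suppose that T is injective on W₁. Its image is then all of M_q = W₀, and the highest weight
    -- vector of W₀ pulls back to a vector of W₁ of weight q + 1/2, which is monogenic and so lies
    -- in W₀ ∩ W₁ = 0.
    have hinj : ∀ u ∈ W₁, T u = 0 → u = 0 := fun u hu hu0 => by
      have : u ∈ W₁ ⊓ LinearMap.ker T := ⟨hu, hu0⟩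
      rwa [h0, Submodule.mem_bot] at this
    have himg := hirr.map (spinRep_comm_of_br hTrot) hinj
    have himg' : W₁.map T = monogenic (cliffordFamily γ) q := by
      refine eq_monogenic_of_isRotInvariant hm hg (isIrreducibleFamily_cliffordFamily hγ)
        himg.ne_bot ?_ (isRotInvariant_of_invariant γ himg.invariant)
      rintro _ ⟨u, hu, rfl⟩
      exact hTmem u hu
    have hv' := hv
    rw [hW₀, ← himg'] at hv'
    obtain ⟨u, hu, rfl⟩ := hv'
    have hL := hhw.weight ⟨0, hm⟩
    rw [wtHook, if_pos rfl, ← hTrot, ← map_smul, ← sub_eq_zero, ← map_sub] at hL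
    have hL' := sub_eq_zero.1 (hinj _ (Submodule.sub_mem _ (hirr.invariant _ u hu)
      (Submodule.smul_mem _ _ hu)) hL)
    have hu0 : u ∈ W₀ := by
      rw [hW₀, monogenic_eq hg]
      exact ⟨hle hu, dirac_eq_zero_of_weight ⟨0, hm⟩ (hle hu) hL'⟩
    have := Submodule.disjoint_def.1 hdec.disjoint u hu0 hu
    exact hhw.ne_zero (by rw [this, map_zero])
  have hfT : T f = 0 := (inf_eq_left.1 hker) hf
  rw [hTapp] at hfT
  exact (eq_neg_of_add_eq_zero_right hfT).symm

end Decomposition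

end SpinorHarmonic

open SpinorHarmonic in
theorem mainTheorem5 (m q : ℕ) (hm : 1 ≤ m)
    {V : Type*} [AddCommGroup V] [Module ℂ V] [FiniteDimensional ℂ V]
    (γ : Cl (2 * m + 1) →ₐ[ℝ] Module.End ℂ V) (hγ : IsSpinorModule γ) :
    IsIrrepOfHighestWeight (spinorRep γ) (wtSpin m) ⊤ ∧
    (∃ W₀ W₁, IsSpinorDecomposition γ q W₀ W₁) ∧
    ∀ W₀ W₁, IsSpinorDecomposition γ q W₀ W₁ →
      (∀ f ∈ W₀, -(cliffordX γ (dirac γ f)) = 0) ∧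
      (∀ f ∈ W₁, -(cliffordX γ (dirac γ f)) =
        (((2 * m + 1 : ℕ) : ℂ) + 2 * (q : ℂ) - 2) • f) ∧
      W₀ = harmonicTensor (2 * m + 1) q V ⊓ LinearMap.ker (dirac γ) ∧
      IsQuotientOf W₁ (harmonicTensor (2 * m + 1) q V) (LinearMap.ker (dirac γ)) := by
  refine ⟨isIrrepOfHighestWeight_spinorRep hγ, exists_isSpinorDecomposition hm hγ q,
    fun W₀ W₁ hdec => ?_⟩
  have hW₀ := hdec.eq_monogenic hm hγ
  have hK : W₀ = harmonicTensor (2 * m + 1) q V ⊓ LinearMap.ker (dirac γ) := by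
    rw [hW₀, monogenic_eq (isCliffordFamily_cliffordFamily γ), dirac_eq]
  refine ⟨fun f hf => ?_, fun f hf => ?_, hK, isQuotientOf_of_sup_eq hdec.disjoint hdec.sup_eq hK⟩
  · rw [hK] at hf
    rw [LinearMap.mem_ker.1 hf.2, map_zero, neg_zero]
  · rw [cliffordX_eq, dirac_eq]
    exact hdec.vec_dirac hm hγ hf
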